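/- Let $k$ be a commutative ring with unit and $Q$ a finite quiver (finitely many vertices $Q_0$ and arrows; loops and multiple arrows allowed). Let $kQ$ be its path algebra, with paths composed from right to left and with $\varepsilon_v$ the empty path at $v$, and let $J$ be the arrow ideal, i.e. the two-sided ideal of $kQ$ with $k$-basis the paths of positive length. Let $I$ be an admissible ideal of $kQ$, i.e. a two-sided ideal such that $J^m\subseteq I\subseteq J^2$ for some $m\ge 2$ and $kQ/I$ is projective as a $k$-module. For two-sided ideals $Y\subseteq X$ of $kQ$, write $\varepsilon_w(X/Y)\varepsilon_v=\{\varepsilon_w z\varepsilon_v+Y : z\in X\}$. Then for all $v,w\in Q_0$, the left and right $kQ$-module structures on $(kQ/J)\varepsilon_v$ and $\varepsilon_w(kQ/J)$, respectively, factor through $kQ/I$, making them a left and a right $kQ/I$-module, and there are isomorphisms of $k$-modules \begin{align*} \operatorname{Tor}_1^{kQ/I}(\varepsilon_w(kQ/J),(kQ/J)\varepsilon_v) &\cong \varepsilon_w(J/J^2)\varepsilon_v,\\ \operatorname{Tor}_2^{kQ/I}(\varepsilon_w(kQ/J),(kQ/J)\varepsilon_v) &\cong \varepsilon_w\bigl(I/(IJ+JI)\bigr)\varepsilon_v,\\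 \operatorname{Tor}_{2n+1}^{kQ/I}(\varepsilon_w(kQ/J),(kQ/J)\varepsilon_v) &\cong \varepsilon_w\left(\frac{I^nJ\cap JI^n}{I^{n+1}+JI^nJ}\right)\varepsilon_v \qquad (n\ge 1),\\ \operatorname{Tor}_{2n}^{kQ/I}(\varepsilon_w(kQ/J),(kQ/J)\varepsilon_v) &\cong \varepsilon_w\left(\frac{I^n\cap JI^{n-1}J}{I^nJ+JI^n}\right)\varepsilon_v \qquad (n\ge 2). \end{align*} Moreover, $\varepsilon_w(J/J^2)\varepsilon_v$ is a free $k$-module with basis the cosets of the arrows from $v$ to $w$. -/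

import Mathlib

open CategoryTheory MulOpposite
open scoped TensorProduct

universe u v w a

noncomputable section

namespace QuiverAlgebra

/-! ### The path algebra of a quiver -/

/-- All directed paths of a quiver: a source, a target and a path between them. -/
abbrev AllPaths (Q : Type v) [Quiver.{w} Q] : Type (max v w) :=
  Σ s t : Q, Quiver.Path s t

/-- The path algebra `kQ`: the free `k`-module on the set of all directed paths. -/
def PathAlgebra (k : Type u) [CommRing k] (Q : Type v) [Quiver.{w} Q] : Type (max u v w) :=
  AllPaths Q →₀ k

namespace PathAlgebra

section Basic

variable (k : Type u) [CommRing k] {Q : Type v} [Quiver.{w} Q]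

instance instAddCommGroup : AddCommGroup (PathAlgebra k Q) :=
  inferInstanceAs (AddCommGroup (AllPaths Q →₀ k))

instance instModule : Module k (PathAlgebra k Q) :=
  inferInstanceAs (Module k (AllPaths Q →₀ k))

/-- The basis element of `kQ` given by a path. -/
def ofPath (p : AllPaths Q) : PathAlgebra k Q := Finsupp.single p 1

/-- The basis element of `kQ` given by the empty path at the vertex `x`. -/
def vertex (x : Q) : PathAlgebra k Q := ofPath k ⟨x, x, Quiver.Path.nil⟩

/-- The basis element of `kQ` given by an arrow. -/
def arrow {x y : Q} (e : x ⟶ y) : PathAlgebra k Q := ofPath k ⟨x, y, e.toPath⟩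

open Classical in
/-- The product `pq` of two paths, composed from right to left: first `q`, then `p`,
if the source of `p` is the target of `q`, and `0` otherwise. -/
def pathMul (p q : AllPaths Q) : PathAlgebra k Q :=
  if h : q.2.1 = p.1 then
    ofPath k ⟨q.1, p.2.1, (q.2.2.cast rfl h).comp p.2.2⟩
  else 0

/-- The bilinear extension of the product of paths. -/
def mulHom : PathAlgebra k Q →ₗ[k] PathAlgebra k Q →ₗ[k] PathAlgebra k Q :=
  Finsupp.linearCombination k fun p : AllPaths Q =>
    (Finsupp.linearCombination k fun q : AllPaths Q => pathMul k p q :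
      (AllPaths Q →₀ k) →ₗ[k] PathAlgebra k Q)

instance instMul : Mul (PathAlgebra k Q) := ⟨fun x y => mulHom k x y⟩

theorem mul_def (x y : PathAlgebra k Q) : x * y = mulHom k x y := rfl

theorem ofPath_mul_ofPath (p q : AllPaths Q) : ofPath k p * ofPath k q = pathMul k p q := by
  rw [mul_def]
  unfold mulHom ofPath
  erw [Finsupp.linearCombination_single, one_smul, Finsupp.linearCombination_single, one_smul]

theorem ofPath_mul_of_eq {x y z : Q} (p : Quiver.Path y z) (q : Quiver.Path x y) :
    ofPath k ⟨y, z, p⟩ * ofPath k ⟨x, y, q⟩ = ofPath k ⟨x, z, q.comp p⟩ := by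
  rw [ofPath_mul_ofPath, pathMul, dif_pos rfl]
  rfl

theorem ofPath_mul_of_ne {p q : AllPaths Q} (h : q.2.1 ≠ p.1) :
    ofPath k p * ofPath k q = 0 := by
  rw [ofPath_mul_ofPath, pathMul, dif_neg h]

@[elab_as_elim]
theorem induction_on {P : PathAlgebra k Q → Prop} (x : PathAlgebra k Q) (h0 : P 0)
    (hadd : ∀ x y, P x → P y → P (x + y)) (hs : ∀ (c : k) (p : AllPaths Q), P (c • ofPath k p)) :
    P x := by
  refine Finsupp.induction_linear (motive := fun f : AllPaths Q →₀ k => P f) x h0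
    (fun f g hf hg => hadd f g hf hg) fun p c => ?_
  have := hs c p
  unfold ofPath at this
  erw [Finsupp.smul_single, smul_eq_mul, mul_one] at this
  exact this

instance instNonUnitalNonAssocRing : NonUnitalNonAssocRing (PathAlgebra k Q) where
  __ := instAddCommGroup k
  __ := instMul k
  left_distrib x y z := by simp only [mul_def, map_add]
  right_distrib x y z := by simp only [mul_def, map_add, LinearMap.add_apply]
  zero_mul x := by simp only [mul_def, map_zero, LinearMap.zero_apply]
  mul_zero x := by simp only [mul_def, map_zero]

theorem smul_mul' (c : k) (x y : PathAlgebra k Q) : c • x * y = c • (x * y) := by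
  simp only [mul_def, map_smul, LinearMap.smul_apply]

theorem mul_smul'' (c : k) (x y : PathAlgebra k Q) : x * c • y = c • (x * y) := by
  simp only [mul_def, map_smul]

theorem ofPath_assoc (p q r : AllPaths Q) :
    ofPath k p * ofPath k q * ofPath k r = ofPath k p * (ofPath k q * ofPath k r) := by
  obtain ⟨p₁, p₂, p⟩ := p
  obtain ⟨q₁, q₂, q⟩ := q
  obtain ⟨r₁, r₂, r⟩ := r
  by_cases h : q₂ = p₁
  · subst h
    by_cases h' : r₂ = q₁
    · subst h'
      simp only [ofPath_mul_of_eq, Quiver.Path.comp_assoc]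
    · rw [ofPath_mul_of_eq, ofPath_mul_of_ne k (q := ⟨r₁, r₂, r⟩) h',
        ofPath_mul_of_ne k (q := ⟨r₁, r₂, r⟩) h', mul_zero]
  · rw [ofPath_mul_of_ne k (q := ⟨q₁, q₂, q⟩) h, zero_mul]
    by_cases h' : r₂ = q₁
    · subst h'
      rw [ofPath_mul_of_eq, ofPath_mul_of_ne]
      exact h
    · rw [ofPath_mul_of_ne k (q := ⟨r₁, r₂, r⟩) h', mul_zero]

theorem mul_assoc' (x y z : PathAlgebra k Q) : x * y * z = x * (y * z) := by
  refine induction_on k x ?_ ?_ ?_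
  · simp only [zero_mul]
  · intro x x' h h'
    simp only [add_mul, h, h']
  intro c p
  refine induction_on k y ?_ ?_ ?_
  · simp only [zero_mul, mul_zero]
  · intro x x' h h'
    simp only [add_mul, mul_add, h, h']
  intro d q
  refine induction_on k z ?_ ?_ ?_
  · simp only [mul_zero]
  · intro x x' h h'
    simp only [mul_add, h, h']
  intro e r
  simp only [smul_mul', mul_smul'', ofPath_assoc]

end Basic

section Ring

variable (k : Type u) [CommRing k] {Q : Type v} [Quiver.{w} Q] [Fintype Q]

/-- The identity of `kQ` is the sum of the empty paths. -/
instance instOne : One (PathAlgebra k Q) := ⟨∑ x : Q, vertex k x⟩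

theorem one_def : (1 : PathAlgebra k Q) = ∑ x : Q, vertex k x := rfl

theorem one_mul' (x : PathAlgebra k Q) : 1 * x = x := by
  refine induction_on k x (mul_zero _) (fun x y hx hy => by rw [mul_add, hx, hy]) fun c p => ?_
  obtain ⟨s, t, p⟩ := p
  rw [mul_smul'', one_def, Finset.sum_mul, Finset.sum_eq_single t]
  · rw [vertex, ofPath_mul_of_eq, Quiver.Path.comp_nil]
  · intro y _ hy
    exact ofPath_mul_of_ne k (Ne.symm hy)
  · simp

theorem mul_one' (x : PathAlgebra k Q) : x * 1 = x := by
  refine induction_on k x (zero_mul _) (fun x y hx hy => by rw [add_mul, hx, hy]) fun c p => ?_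
  obtain ⟨s, t, p⟩ := p
  rw [smul_mul', one_def, Finset.mul_sum, Finset.sum_eq_single s]
  · rw [vertex, ofPath_mul_of_eq, Quiver.Path.nil_comp]
  · intro y _ hy
    exact ofPath_mul_of_ne k hy
  · simp

instance instRing : Ring (PathAlgebra k Q) where
  __ := instNonUnitalNonAssocRing k
  __ := instOne k
  mul_assoc := mul_assoc' k
  one_mul := one_mul' k
  mul_one := mul_one' k

instance instAlgebra : Algebra k (PathAlgebra k Q) :=
  Algebra.ofModule (smul_mul' k) (mul_smul'' k)

end Ring

end PathAlgebra

open PathAlgebra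

section Ideals

variable (k : Type u) [CommRing k] (Q : Type v) [Quiver.{w} Q] [Fintype Q]

/-- The arrow ideal `J` of `kQ`: the `k`-span of the paths of positive length. -/
def arrowIdeal : Ideal (PathAlgebra k Q) where
  __ := Submodule.span k {x : PathAlgebra k Q | ∃ p : AllPaths Q, 0 < p.2.2.length ∧ x = ofPath k p}
  smul_mem' := by
    intro c x hx
    change x ∈ Submodule.span k _ at hx
    change c * x ∈ Submodule.span k _
    refine Submodule.span_induction (fun x hx => ?_) ?_ (fun x y _ _ hx hy => ?_)
      (fun d x _ hx => ?_) hx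
    · obtain ⟨⟨s, t, p⟩, hp, rfl⟩ := hx
      refine induction_on k c ?_ (fun x y hx hy => ?_) fun d q => ?_
      · rw [zero_mul]; exact Submodule.zero_mem _
      · rw [add_mul]; exact Submodule.add_mem _ hx hy
      · rw [smul_mul']
        refine Submodule.smul_mem _ _ ?_
        obtain ⟨s', t', q⟩ := q
        by_cases h : t = s'
        · subst h
          rw [ofPath_mul_of_eq]
          refine Submodule.subset_span ⟨_, ?_, rfl⟩
          simp only [Quiver.Path.length_comp] at hp ⊢
          omega
        · rw [ofPath_mul_of_ne k (q := ⟨s, t, p⟩) h]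
          exact Submodule.zero_mem _
    · rw [mul_zero]; exact Submodule.zero_mem _
    · rw [mul_add]; exact Submodule.add_mem _ hx hy
    · rw [mul_smul'']; exact Submodule.smul_mem _ _ hx

instance arrowIdeal_isTwoSided : (arrowIdeal k Q).IsTwoSided where
  mul_mem_of_left := by
    intro x c hx
    change x ∈ Submodule.span k _ at hx
    change x * c ∈ Submodule.span k _
    refine Submodule.span_induction (fun x hx => ?_) ?_ (fun x y _ _ hx hy => ?_)
      (fun d x _ hx => ?_) hx
    · obtain ⟨⟨s, t, p⟩, hp, rfl⟩ := hx
      refine induction_on k c ?_ (fun x y hx hy => ?_) fun d q => ?_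
      · rw [mul_zero]; exact Submodule.zero_mem _
      · rw [mul_add]; exact Submodule.add_mem _ hx hy
      · rw [mul_smul'']
        refine Submodule.smul_mem _ _ ?_
        obtain ⟨s', t', q⟩ := q
        by_cases h : t' = s
        · subst h
          rw [ofPath_mul_of_eq]
          refine Submodule.subset_span ⟨_, ?_, rfl⟩
          simp only [Quiver.Path.length_comp] at hp ⊢
          omega
        · rw [ofPath_mul_of_ne k (q := ⟨s', t', q⟩) h]
          exact Submodule.zero_mem _
    · rw [zero_mul]; exact Submodule.zero_mem _
    · rw [add_mul]; exact Submodule.add_mem _ hx hy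
    · rw [smul_mul']; exact Submodule.smul_mem _ _ hx

variable {Q}

/-- A two-sided ideal `I` of `kQ` is admissible if `J ^ n ⊆ I ⊆ J ^ 2` for some `n ≥ 2` and
`kQ / I` is projective over `k`. -/
structure IsAdmissible (I : Ideal (PathAlgebra k Q)) [I.IsTwoSided] : Prop where
  exists_pow_le : ∃ n : ℕ, 2 ≤ n ∧ arrowIdeal k Q ^ n ≤ I
  le_sq : I ≤ arrowIdeal k Q ^ 2
  projective : Module.Projective k (PathAlgebra k Q ⧸ I)

/-- `(kQ/J) ε_x`, the left ideal of `kQ/J` generated by the class of `ε_x`. -/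
def leftSimple (x : Q) : Ideal (PathAlgebra k Q ⧸ arrowIdeal k Q) :=
  Submodule.span (PathAlgebra k Q ⧸ arrowIdeal k Q)
    {Ideal.Quotient.mk (arrowIdeal k Q) (vertex k x)}

/-- `ε_x (kQ/J)`, the right ideal of `kQ/J` generated by the class of `ε_x`. -/
def rightSimple (x : Q) : Submodule (PathAlgebra k Q ⧸ arrowIdeal k Q)ᵐᵒᵖ
    (PathAlgebra k Q ⧸ arrowIdeal k Q) :=
  Submodule.span (PathAlgebra k Q ⧸ arrowIdeal k Q)ᵐᵒᵖ
    {Ideal.Quotient.mk (arrowIdeal k Q) (vertex k x)}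

/-- `ε_y (X/Y) ε_x` for two-sided ideals `Y ⊆ X` of `kQ`, as a `k`-submodule of `kQ/Y`
(which contains `X/Y`): the set of all classes `ε_y z ε_x + Y` with `z ∈ X`. -/
def corner (y x : Q) (X Y : Ideal (PathAlgebra k Q)) : Submodule k (PathAlgebra k Q ⧸ Y) :=
  (X.restrictScalars k).map
    ((Submodule.mkQ Y).restrictScalars k ∘ₗ LinearMap.mulLeftRight k (vertex k y, vertex k x))

theorem mem_corner (y x : Q) (X Y : Ideal (PathAlgebra k Q)) (c : PathAlgebra k Q ⧸ Y) :
    c ∈ corner k y x X Y ↔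
      ∃ z ∈ X, Submodule.Quotient.mk (vertex k y * z * vertex k x) = c :=
  Iff.rfl

end Ideals

/-! ### Tensor products and Tor over a noncommutative algebra -/

section Tor

variable (k : Type u) [CommRing k] (A : Type a) [Ring A] [Algebra k A]

/-- The submodule of `M ⊗_ℤ N` spanned by all `m a ⊗ n - m ⊗ a n`. -/
def balancedRelations (M : Type a) [AddCommGroup M] [Module k M] [Module Aᵐᵒᵖ M]
    (N : Type a) [AddCommGroup N] [Module A N] : Submodule k (M ⊗[ℤ] N) :=
  Submodule.span k {z | ∃ (m : M) (r : A) (n : N), z = (op r • m) ⊗ₜ[ℤ] n - m ⊗ₜ[ℤ] (r • n)}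

/-- The tensor product `M ⊗_A N` of a right `A`-module `M` and a left `A`-module `N`.
It is a `k`-module through `M`. -/
abbrev BalancedTensor (M : Type a) [AddCommGroup M] [Module k M] [Module Aᵐᵒᵖ M]
    [IsScalarTower k Aᵐᵒᵖ M] (N : Type a) [AddCommGroup N] [Module A N] : Type a :=
  (M ⊗[ℤ] N) ⧸ balancedRelations k A M N

variable (M : Type a) [AddCommGroup M] [Module k M] [Module Aᵐᵒᵖ M] [IsScalarTower k Aᵐᵒᵖ M]

/-- The map `M ⊗_A N → M ⊗_A N'`, `m ⊗ n ↦ m ⊗ f n`, induced by an `A`-linear map `f`. -/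
def balancedMap {N N' : Type a} [AddCommGroup N] [Module A N] [AddCommGroup N'] [Module A N']
    (f : N →ₗ[A] N') : BalancedTensor k A M N →ₗ[k] BalancedTensor k A M N' :=
  Submodule.mapQ _ _
    (TensorProduct.AlgebraTensorModule.map (LinearMap.id : M →ₗ[k] M) f.toAddMonoidHom.toIntLinearMap)
    (by
      refine Submodule.span_le.2 ?_
      rintro _ ⟨m, r, n, rfl⟩
      refine Submodule.subset_span ⟨m, r, f n, ?_⟩
      simp [map_sub])

theorem balancedMap_mk {N N' : Type a} [AddCommGroup N] [Module A N] [AddCommGroup N'] [Module A N']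
    (f : N →ₗ[A] N') (m : M) (n : N) :
    balancedMap k A M f (Submodule.Quotient.mk (m ⊗ₜ n)) = Submodule.Quotient.mk (m ⊗ₜ f n) := rfl

theorem balanced_hom_ext {N : Type a} [AddCommGroup N] [Module A N] {P : Type a} [AddCommGroup P]
    [Module k P] {f g : BalancedTensor k A M N →ₗ[k] P}
    (h : ∀ (m : M) (n : N), f (Submodule.Quotient.mk (m ⊗ₜ n)) =
      g (Submodule.Quotient.mk (m ⊗ₜ n))) : f = g := by
  refine Submodule.linearMap_qext _ (TensorProduct.AlgebraTensorModule.ext ?_)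
  intro m n
  exact h m n

/-- The functor `M ⊗_A -` from left `A`-modules to `k`-modules. -/
def balancedTensorFunctor : ModuleCat.{a} A ⥤ ModuleCat.{a} k where
  obj N := ModuleCat.of k (BalancedTensor k A M N)
  map f := ModuleCat.ofHom (balancedMap k A M f.hom)
  map_id N := by
    apply ModuleCat.hom_ext
    exact balanced_hom_ext k A M fun m n => rfl
  map_comp f g := by
    apply ModuleCat.hom_ext
    exact balanced_hom_ext k A M fun m n => rfl

instance balancedTensorFunctor_additive : (balancedTensorFunctor k A M).Additive where
  map_add {N N' f g} := by
    apply ModuleCat.hom_ext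
    refine balanced_hom_ext k A M fun m n => ?_
    change Submodule.Quotient.mk (m ⊗ₜ (f.hom n + g.hom n)) =
      (Submodule.Quotient.mk (m ⊗ₜ f.hom n) + Submodule.Quotient.mk (m ⊗ₜ g.hom n) :
        BalancedTensor k A M N')
    rw [TensorProduct.tmul_add, Submodule.Quotient.mk_add]

/-- `Tor_n^A(M, N)`, a `k`-module: the value at `N` of the `n`-th left derived functor
of `M ⊗_A -`. -/
abbrev TorModule (N : Type a) [AddCommGroup N] [Module A N] (n : ℕ) : ModuleCat.{a} k :=
  ((balancedTensorFunctor k A M).leftDerived n).obj (ModuleCat.of A N)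

end Tor

end QuiverAlgebra

end

/-!
The theorem is proved by writing down a projective resolution of `(kQ/J) ε_x` over `A = kQ/I`
made from ideals of `R = kQ`, and tensoring it.

*Projectivity.* A left ideal `X` of `R` such that `R/X` is projective over `k` is a projective left
`R`-module (`projective_of_projective_quotient`). The reason is that `R` is a tensor algebra over
the span of the `ε_v`: a surjection from a free module onto `X` has a `k`-linear section which
commutes with the `ε_v`, and its failure to commute with arrows is corrected by a recursion on the
length of paths (`pathCorrection`), which starts from all of `R` because `X` is a `k`-summand of
`R`. This applies to `X = I` and to
`X = J`. A product `I * P` of a two-sided ideal and a left ideal, both projective as left modules,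
is again projective (`projective_mul`).

*The resolution.* Hence all members `Y n` of the chain `R ⊇ J ⊇ I ⊇ I J ⊇ I² ⊇ I² J ⊇ ⋯`
(`idealChain`) are projective left modules, and so are the left ideals `X n = (Y n) ε_x`. As
`Y (n + 2) = I * Y n`, the kernel of `X (n + 1) / I X (n + 1) → X n / I X n` is
`X (n + 2) / I X (n + 1)`, so the `A`-modules `X n / I X n` with the maps induced by inclusion
form a projective resolution of `X 0 / X 1 = (kQ/J) ε_x`.

*Homology.* The tensor product `ε_y (R/J) ⊗ X / I X` is `ε_y X / ε_y J X`: the map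
`z ↦ ε_y ⊗ z` is onto (`genTensor_surjective`), and `ε_y ⊗ z = 0` exactly when `ε_y z ∈ J X`
(`genTensor_eq_zero_iff`). The homology in degree `n + 1` is therefore the `(ε_y, ε_x)`-corner of
`(Y (n + 1) ∩ J Y n) / (Y (n + 2) + J Y (n + 1))`
(`nonempty_torModule_linearEquiv_idempotentCorner`), and inserting the even and the odd members of
the chain gives the four formulas.

The classes of the arrows span `ε_y (J/J²) ε_x`, and they are linearly independent because the
coefficients at arrows vanish on `J²`.
-/

noncomputable section

namespace QuiverAlgebra

open PathAlgebra

/-! ### Derived functors from explicit resolutions -/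

section Resolution

variable {A : Type a} [Ring A] {P : ℕ → Type a} [∀ n, AddCommGroup (P n)] [∀ n, Module A (P n)]
  {N : Type a} [AddCommGroup N] [Module A N]

/-- The chain complex of a sequence of modules and linear maps with vanishing composites. -/
def moduleComplex (d : ∀ n, P (n + 1) →ₗ[A] P n) (hd : ∀ n, d n ∘ₗ d (n + 1) = 0) :
    ChainComplex (ModuleCat.{a} A) ℕ :=
  ChainComplex.of (fun n => ModuleCat.of A (P n)) (fun n => ModuleCat.ofHom (d n))
    fun n => ModuleCat.hom_ext (hd n)

theorem moduleComplex_d (d : ∀ n, P (n + 1) →ₗ[A] P n) (hd : ∀ n, d n ∘ₗ d (n + 1) = 0) (n : ℕ) :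
    (moduleComplex d hd).d (n + 1) n = ModuleCat.ofHom (d n) :=
  ChainComplex.of_d (fun n => ModuleCat.of A (P n)) (fun n => ModuleCat.ofHom (d n)) n

theorem moduleComplex_d_apply (d : ∀ n, P (n + 1) →ₗ[A] P n)
    (hd : ∀ n, d n ∘ₗ d (n + 1) = 0) (n : ℕ) (z : P (n + 1)) :
    ((moduleComplex d hd).d (n + 1) n).hom z = d n z := by
  rw [moduleComplex_d]
  rfl

/-- A projective resolution given by explicit modules and linear maps. -/
def moduleResolution (d : ∀ n, P (n + 1) →ₗ[A] P n) (π : P 0 →ₗ[A] N)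
    [∀ n, Module.Projective A (P n)] (hex : ∀ n, Function.Exact (d (n + 1)) (d n))
    (hex₀ : Function.Exact (d 0) π) (hπ : Function.Surjective π) :
    ProjectiveResolution (ModuleCat.of A N) where
  complex := moduleComplex d fun n => (hex n).linearMap_comp_eq_zero
  projective n := (IsProjective.iff_projective (P n)).1 inferInstance
  π := (ChainComplex.toSingle₀Equiv _ _).symm ⟨ModuleCat.ofHom π, by
    rw [moduleComplex_d]
    exact ModuleCat.hom_ext hex₀.linearMap_comp_eq_zero⟩
  quasiIso := ⟨fun n => by
    cases n with
    | zero =>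
      rw [ChainComplex.quasiIsoAt₀_iff, ShortComplex.quasiIso_iff_of_zeros' _ rfl rfl rfl]
      constructor
      · rw [ShortComplex.moduleCat_exact_iff]
        intro z hz
        replace hz : π z = 0 := by simpa [ChainComplex.toSingle₀Equiv] using! hz
        obtain ⟨t, ht⟩ := (hex₀ z).1 hz
        exact ⟨t, (moduleComplex_d_apply d (fun n => (hex n).linearMap_comp_eq_zero) 0 t).trans ht⟩
      · rw [ModuleCat.epi_iff_surjective]
        simpa [ChainComplex.toSingle₀Equiv] using! hπ
    | succ n =>
      rw [quasiIsoAt_iff_exactAt']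
      · rw [HomologicalComplex.exactAt_iff' _ (n + 2) (n + 1) n (by simp) (by simp),
          ShortComplex.moduleCat_exact_iff]
        intro z hz
        have hd : ∀ n, d n ∘ₗ d (n + 1) = 0 := fun n => (hex n).linearMap_comp_eq_zero
        obtain ⟨t, ht⟩ := (hex n z).1 ((moduleComplex_d_apply d hd n z).symm.trans hz)
        exact ⟨t, (moduleComplex_d_apply d hd (n + 1) t).trans ht⟩
      · exact ChainComplex.exactAt_succ_single_obj _ _⟩

/-- If `W` maps to the cycles of a short complex of modules and hits every cycle up to boundaries,
then the homology is the quotient `C` of `W` by the preimage of the boundaries. -/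
theorem nonempty_homology_linearEquiv {k : Type u} [CommRing k] (S : ShortComplex (ModuleCat.{a} k))
    {W : Type a} [AddCommGroup W] [Module k W] {C : Type a} [AddCommGroup C] [Module k C]
    (ψ : W →ₗ[k] S.X₂) (hψ : ∀ w, S.g.hom (ψ w) = 0)
    (hsurj : ∀ z : S.X₂, S.g.hom z = 0 → ∃ w t, z = ψ w + S.f.hom t)
    (χ : W →ₗ[k] C) (hχ : Function.Surjective χ)
    (hker : ∀ w, χ w = 0 ↔ ∃ t, S.f.hom t = ψ w) :
    Nonempty (S.homology ≃ₗ[k] C) := by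
  let ρ : W →ₗ[k] LinearMap.ker S.g.hom ⧸ LinearMap.range S.moduleCatToCycles :=
    Submodule.mkQ _ ∘ₗ ψ.codRestrict (LinearMap.ker S.g.hom) hψ
  have hρ : Function.Surjective ρ := by
    intro q
    obtain ⟨⟨z, hz⟩, rfl⟩ := Submodule.Quotient.mk_surjective _ q
    obtain ⟨w, t, rfl⟩ := hsurj z hz
    refine ⟨w, (Submodule.Quotient.eq _).2 ⟨-t, Subtype.ext ?_⟩⟩
    change S.f.hom (-t) = ψ w - (ψ w + S.f.hom t)
    rw [map_neg]
    abel
  have hρk : LinearMap.ker ρ = LinearMap.ker χ := by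
    ext w
    rw [LinearMap.mem_ker, LinearMap.mem_ker, hker]
    refine (Submodule.Quotient.mk_eq_zero _).trans ⟨?_, ?_⟩
    · rintro ⟨t, ht⟩
      exact ⟨t, congrArg Subtype.val ht⟩
    · rintro ⟨t, ht⟩
      exact ⟨t, Subtype.ext ht⟩
  exact ⟨S.moduleCatHomologyIso.toLinearEquiv ≪≫ₗ
    (ρ.quotKerEquivOfSurjective hρ).symm ≪≫ₗ Submodule.quotEquivOfEq _ _ hρk ≪≫ₗ
    χ.quotKerEquivOfSurjective hχ⟩

/-- `Tor` in positive degrees from an explicit projective resolution `P`: if `W` maps to the cycles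
in `M ⊗ P (n + 1)` and hits every cycle up to boundaries, then `Tor_{n+1}` is the quotient `C` of
`W` by the preimage of the boundaries. -/
theorem nonempty_torModule_linearEquiv (k : Type u) [CommRing k] [Algebra k A]
    (M : Type a) [AddCommGroup M] [Module k M] [Module Aᵐᵒᵖ M] [IsScalarTower k Aᵐᵒᵖ M]
    (d : ∀ n, P (n + 1) →ₗ[A] P n) (π : P 0 →ₗ[A] N)
    [∀ n, Module.Projective A (P n)] (hex : ∀ n, Function.Exact (d (n + 1)) (d n))
    (hex₀ : Function.Exact (d 0) π) (hπ : Function.Surjective π) (n : ℕ)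
    {W : Type a} [AddCommGroup W] [Module k W] {C : Type a} [AddCommGroup C] [Module k C]
    (ψ : W →ₗ[k] BalancedTensor k A M (P (n + 1)))
    (hψ : ∀ w, balancedMap k A M (d n) (ψ w) = 0)
    (hsurj : ∀ z, balancedMap k A M (d n) z = 0 →
      ∃ w t, z = ψ w + balancedMap k A M (d (n + 1)) t)
    (χ : W →ₗ[k] C) (hχ : Function.Surjective χ)
    (hker : ∀ w, χ w = 0 ↔ ∃ t, balancedMap k A M (d (n + 1)) t = ψ w) :
    Nonempty (TorModule k A M N (n + 1) ≃ₗ[k] C) := by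
  let R := moduleResolution d π hex hex₀ hπ
  let K := ((balancedTensorFunctor k A M).mapHomologicalComplex _).obj R.complex
  have hd (m : ℕ) : (K.d (m + 1) m).hom = balancedMap k A M (d m) := by
    change (((balancedTensorFunctor k A M).map (R.complex.d (m + 1) m))).hom = _
    rw [show R.complex.d (m + 1) m = ModuleCat.ofHom (d m) from
      moduleComplex_d d (fun n => (hex n).linearMap_comp_eq_zero) m]
    rfl
  obtain ⟨e⟩ : Nonempty ((K.sc' (n + 2) (n + 1) n).homology ≃ₗ[k] C) := by
    refine nonempty_homology_linearEquiv (K.sc' (n + 2) (n + 1) n) ψ ?_ ?_ χ hχ ?_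
    · intro w
      exact (LinearMap.congr_fun (hd n) (ψ w)).trans (hψ w)
    · intro z hz
      obtain ⟨w, t, h⟩ := hsurj z ((LinearMap.congr_fun (hd n) z).symm.trans hz)
      exact ⟨w, t, h.trans (congrArg (ψ w + ·) (LinearMap.congr_fun (hd (n + 1)) t).symm)⟩
    · intro w
      rw [hker]
      refine exists_congr fun t => ?_
      exact (LinearMap.congr_fun (hd (n + 1)) t).symm ▸ Iff.rfl
  exact ⟨(R.isoLeftDerivedObj (balancedTensorFunctor k A M) (n + 1) ≪≫
    K.homologyIsoSc' (n + 2) (n + 1) n (by simp) (by simp)).toLinearEquiv ≪≫ₗ e⟩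

end Resolution

/-! ### Projectivity of products of ideals and of quotients -/

section Projective

variable {R : Type a} [Ring R]

/-- If `I` is a two-sided ideal and `P` a left ideal, both projective as left modules, then `I * P`
is projective: coordinates on `P` send `I * P` into `I`, so `I * P` is a retract of a direct sum
of copies of `I`. -/
theorem projective_mul (I P : Ideal R) [I.IsTwoSided] [Module.Projective R I]
    [Module.Projective R P] : Module.Projective R (I * P : Ideal R) := by
  obtain ⟨s, hs⟩ := (Module.projective_def' (R := R) (P := P)).1 inferInstance
  have hIP : I * P ≤ P := Submodule.smul_le.2 fun r _ _ hz => P.smul_mem r hz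
  let ι : (P →₀ I) →ₗ[R] (P →₀ R) := Finsupp.mapRange.linearMap I.subtype
  have hι : Function.Injective ι :=
    Finsupp.mapRange_injective _ (map_zero _) Subtype.val_injective
  -- the coordinates of an element of `I * P` lie in `I`
  have hmem (z : (I * P : Ideal R)) :
      (s ∘ₗ Submodule.inclusion hIP) z ∈ LinearMap.range ι := by
    rw [Finsupp.range_mapRange_linearMap _ I.ker_subtype, Submodule.range_subtype]
    have hz : Submodule.inclusion hIP z ∈ (I • ⊤ : Submodule R P) :=
      (Submodule.mem_smul_top_iff I P _).2 z.2
    refine Submodule.smul_induction_on (p := fun m => s m ∈ Finsupp.submodule fun _ => I) hz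
      (fun r hr m _ i => ?_) fun m m' hm hm' => ?_
    · rw [map_smul]
      exact I.mul_mem_right _ hr
    · rw [map_add]
      exact Submodule.add_mem _ hm hm'
  let q : (P →₀ I) →ₗ[R] (I * P : Ideal R) := Finsupp.lsum ℕ fun p : P =>
    { toFun := fun c => ⟨c * p, Ideal.mul_mem_mul c.2 p.2⟩
      map_add' := fun c c' => Subtype.ext (add_mul _ _ _)
      map_smul' := fun r c => Subtype.ext (mul_assoc _ _ _) }
  have hq : (I * P).subtype ∘ₗ q = P.subtype ∘ₗ Finsupp.linearCombination R id ∘ₗ ι := by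
    refine Finsupp.lhom_ext fun p c => ?_
    simp [q, ι]
  have : Module.Projective R (P →₀ I) := by
    classical exact Module.Projective.of_equiv' (finsuppLequivDFinsupp R).symm
  refine Module.Projective.of_split ((LinearEquiv.ofInjective ι hι).symm.toLinearMap ∘ₗ
    (s ∘ₗ Submodule.inclusion hIP).codRestrict _ hmem) q ?_
  ext z
  have h₁ := LinearMap.congr_fun hq ((LinearEquiv.ofInjective ι hι).symm
    ((s ∘ₗ Submodule.inclusion hIP).codRestrict _ hmem z))
  have h₂ : ι ((LinearEquiv.ofInjective ι hι).symm
      ((s ∘ₗ Submodule.inclusion hIP).codRestrict _ hmem z)) = s (Submodule.inclusion hIP z) :=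
    congrArg Subtype.val ((LinearEquiv.ofInjective ι hι).apply_symm_apply
      ((s ∘ₗ Submodule.inclusion hIP).codRestrict _ hmem z))
  refine h₁.trans ?_
  rw [LinearMap.comp_apply, LinearMap.comp_apply, h₂]
  exact congrArg Subtype.val (LinearMap.congr_fun hs (Submodule.inclusion hIP z))

/-- An additive map between modules over `R ⧸ I` that is `R`-linear is `R ⧸ I`-linear. -/
def extendQuotient (I : Ideal R) [I.IsTwoSided] {M N : Type*} [AddCommGroup M] [AddCommGroup N]
    [Module (R ⧸ I) M] [Module (R ⧸ I) N] (g : M →+ N)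
    (h : ∀ (r : R) m, g (Ideal.Quotient.mk I r • m) = Ideal.Quotient.mk I r • g m) :
    M →ₗ[R ⧸ I] N where
  __ := g
  map_smul' c m := by
    obtain ⟨r, rfl⟩ := Ideal.Quotient.mk_surjective c
    exact h r m

/-- `M / I M` is projective over `R / I` if `M` is projective over `R`. -/
instance projective_quotient_smul_top (I : Ideal R) [I.IsTwoSided] (M : Type*) [AddCommGroup M]
    [Module R M] [Module.Projective R M] :
    Module.Projective (R ⧸ I) (M ⧸ (I • ⊤ : Submodule R M)) := by
  obtain ⟨s, hs⟩ := (Module.projective_def' (R := R) (P := M)).1 inferInstance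
  let t : M →ₗ[R] (M →₀ R ⧸ I) := Finsupp.mapRange.linearMap (Submodule.mkQ I) ∘ₗ s
  have ht : (I • ⊤ : Submodule R M) ≤ LinearMap.ker t := by
    refine Submodule.smul_le.2 fun r hr m _ => ?_
    rw [LinearMap.mem_ker, map_smul]
    ext i
    refine (Submodule.Quotient.mk_eq_zero I (x := r * s m i)).2 (I.mul_mem_right _ hr)
  let i : (M ⧸ (I • ⊤ : Submodule R M)) →ₗ[R ⧸ I] (M →₀ R ⧸ I) :=
    extendQuotient I (Submodule.liftQ _ t ht).toAddMonoidHom fun r m => by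
      obtain ⟨m, rfl⟩ := Submodule.Quotient.mk_surjective _ m
      change t (r • m) = _
      rw [map_smul]
      rfl
  let p : (M →₀ R ⧸ I) →ₗ[R ⧸ I] (M ⧸ (I • ⊤ : Submodule R M)) :=
    Finsupp.linearCombination (R ⧸ I) Submodule.Quotient.mk
  refine Module.Projective.of_split i p (LinearMap.ext fun m => ?_)
  obtain ⟨m, rfl⟩ := Submodule.Quotient.mk_surjective _ m
  have key (c : M →₀ R) : p (Finsupp.mapRange.linearMap (Submodule.mkQ I) c) =
      Submodule.Quotient.mk (Finsupp.linearCombination R id c) := by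
    induction c using Finsupp.induction_linear with
    | zero => simp
    | add c c' h h' => rw [map_add, map_add, h, h', map_add, Submodule.Quotient.mk_add]
    | single m r =>
      rw [Finsupp.mapRange.linearMap_apply, Finsupp.mapRange_single,
        Finsupp.linearCombination_single, Finsupp.linearCombination_single]
      rfl
  exact (key (s m)).trans (congrArg _ (LinearMap.congr_fun hs m))

/-- The left ideal `Y f` of the elements of `Y` fixed by right multiplication by `f`,
for an idempotent `f` and a two-sided ideal `Y`. -/
def fixedIdeal (f : R) (Y : Ideal R) : Ideal R where
  carrier := {z | z ∈ Y ∧ z * f = z}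
  add_mem' := fun hz hz' => ⟨Y.add_mem hz.1 hz'.1, by rw [add_mul, hz.2, hz'.2]⟩
  zero_mem' := ⟨Y.zero_mem, zero_mul f⟩
  smul_mem' := fun r _ hz => ⟨Y.smul_mem r hz.1, by rw [smul_eq_mul, mul_assoc, hz.2]⟩

theorem mul_mem_fixedIdeal {f : R} (hf : f * f = f) {Y : Ideal R} [Y.IsTwoSided] {z : R}
    (hz : z ∈ Y) : z * f ∈ fixedIdeal f Y :=
  ⟨Y.mul_mem_right f hz, by rw [mul_assoc, hf]⟩

theorem projective_fixedIdeal {f : R} (hf : f * f = f) (Y : Ideal R) [Y.IsTwoSided]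
    [Module.Projective R Y] : Module.Projective R (fixedIdeal f Y) :=
  Module.Projective.of_split (Submodule.inclusion fun _ hz => hz.1 : fixedIdeal f Y →ₗ[R] Y)
    { toFun := fun z => ⟨z * f, mul_mem_fixedIdeal hf z.2⟩
      map_add' := fun _ _ => Subtype.ext (add_mul _ _ _)
      map_smul' := fun _ _ => Subtype.ext (mul_assoc _ _ _) }
    (LinearMap.ext fun z => Subtype.ext z.2.2)

/-- `X (Y f) = (X Y) f`. -/
theorem mul_fixedIdeal {f : R} (hf : f * f = f) (X Y : Ideal R) [Y.IsTwoSided] :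
    X * fixedIdeal f Y = fixedIdeal f (X * Y) := by
  have hright {z : R} (hz : z ∈ X * Y) : z * f ∈ X * fixedIdeal f Y := by
    refine Submodule.smul_induction_on (p := fun z => z * f ∈ X * fixedIdeal f Y) hz
      (fun x hx y hy => ?_) fun z z' h h' => ?_
    · rw [smul_eq_mul, mul_assoc]
      exact Ideal.mul_mem_mul hx (mul_mem_fixedIdeal hf hy)
    · rw [add_mul]
      exact Ideal.add_mem _ h h'
  refine le_antisymm (Submodule.smul_le.2 fun x hx y hy => ?_) fun z hz => ?_
  · exact ⟨Ideal.mul_mem_mul hx hy.1, by rw [smul_eq_mul, mul_assoc, hy.2]⟩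
  · exact hz.2 ▸ hright hz.1

end Projective

/-! ### Tensoring the layers with a cyclic right module -/

section QuotientModules

variable {R : Type a} [Ring R] (I : Ideal R)

/-- The `R ⧸ I`-module `X / I X` of a left ideal `X`. -/
abbrev LayerModule (X : Ideal R) : Type a := X ⧸ (I • ⊤ : Submodule R X)

theorem layer_mk_eq_zero {X : Ideal R} (z : X) :
    (Submodule.Quotient.mk z : LayerModule I X) = 0 ↔ (z : R) ∈ I * X :=
  (Submodule.Quotient.mk_eq_zero _).trans (Submodule.mem_smul_top_iff I X z)

variable [I.IsTwoSided]

/-- The map `X / I X → X' / I X'` induced by an inclusion `X ≤ X'`. -/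
def layerMap {X X' : Ideal R} (h : X ≤ X') : LayerModule I X →ₗ[R ⧸ I] LayerModule I X' :=
  extendQuotient I (Submodule.mapQ _ _ (Submodule.inclusion h)
    (Submodule.smul_le.2 fun r hr z _ => by
      rw [Submodule.mem_comap, map_smul]
      exact Submodule.smul_mem_smul hr trivial)).toAddMonoidHom fun r m => by
      obtain ⟨m, rfl⟩ := Submodule.Quotient.mk_surjective _ m
      rfl

theorem layerMap_mk {X X' : Ideal R} (h : X ≤ X') (z : X) :
    layerMap I h (Submodule.Quotient.mk z) = Submodule.Quotient.mk (Submodule.inclusion h z) := rfl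

/-- If `X = I X''`, then both the image and the kernel in question are `X / I X'`. -/
theorem layerMap_exact {X X' X'' : Ideal R} (h : X ≤ X') (h' : X' ≤ X'') (hX : X = I * X'') :
    Function.Exact (layerMap I h) (layerMap I h') := by
  intro m
  obtain ⟨z, rfl⟩ := Submodule.Quotient.mk_surjective _ m
  rw [layerMap_mk, layer_mk_eq_zero, ← hX]
  constructor
  · intro hz
    exact ⟨Submodule.Quotient.mk ⟨z, hz⟩, rfl⟩
  · rintro ⟨m, hm⟩
    obtain ⟨y, rfl⟩ := Submodule.Quotient.mk_surjective _ m
    rw [layerMap_mk, Submodule.Quotient.eq, Submodule.mem_smul_top_iff] at hm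
    have hle : I * X' ≤ X := hX ▸ Ideal.mul_mono_right h'
    have hsub := X.sub_mem y.2 (hle hm)
    simpa using hsub

end QuotientModules

section Tensor

variable {k : Type u} [CommRing k] {R : Type a} [Ring R] [Algebra k R]
  {I J : Ideal R} [I.IsTwoSided] [J.IsTwoSided] {e : R}
  [Module (R ⧸ I)ᵐᵒᵖ (Submodule.span (R ⧸ J)ᵐᵒᵖ {Ideal.Quotient.mk J e})]
  [IsScalarTower k (R ⧸ I)ᵐᵒᵖ (Submodule.span (R ⧸ J)ᵐᵒᵖ {Ideal.Quotient.mk J e})]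

variable (J e) in
/-- The right ideal `e (R/J)`. -/
abbrev RightSpan : Type a := Submodule.span (R ⧸ J)ᵐᵒᵖ {Ideal.Quotient.mk J e}

variable (J e) in
/-- The generator of `e (R/J)`. -/
def rightGen : RightSpan J e := ⟨Ideal.Quotient.mk J e, Submodule.mem_span_singleton_self _⟩

/-- Elements of `R` may be moved across the tensor product over `R ⧸ I`. -/
theorem balanced_mk (M : Type a) [AddCommGroup M] [Module k M] [Module (R ⧸ I)ᵐᵒᵖ M]
    [IsScalarTower k (R ⧸ I)ᵐᵒᵖ M] {X : Ideal R} (m : M) (r : R) (z : X) :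
    (Submodule.Quotient.mk ((op (Ideal.Quotient.mk I r) • m) ⊗ₜ Submodule.Quotient.mk z) :
      BalancedTensor k (R ⧸ I) M (LayerModule I X)) =
      Submodule.Quotient.mk (m ⊗ₜ Submodule.Quotient.mk (r • z)) :=
  (Submodule.Quotient.eq _).2 (Submodule.subset_span ⟨_, _, _, rfl⟩)

variable (k I J e) in
/-- The map `X → e (R/J) ⊗ X / I X`, `z ↦ e ⊗ z`. -/
def genTensor (X : Ideal R) :
    X →ₗ[k] BalancedTensor k (R ⧸ I) (RightSpan J e) (LayerModule I X) where
  toFun z := Submodule.Quotient.mk (rightGen J e ⊗ₜ Submodule.Quotient.mk z)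
  map_add' z z' := by
    rw [Submodule.Quotient.mk_add, TensorProduct.tmul_add, Submodule.Quotient.mk_add]
  map_smul' c z := by
    have h₁ : (Submodule.Quotient.mk (c • z) : LayerModule I X) =
        Ideal.Quotient.mk I (algebraMap k R c) • Submodule.Quotient.mk z := by
      rw [Module.Quotient.mk_smul_mk, algebraMap_smul]
    -- scalars act through `R ⧸ I` on either side, so they can be moved across the tensor product
    have h₂ : op (Ideal.Quotient.mk I (algebraMap k R c)) • rightGen J e = c • rightGen J e := by
      have h := smul_assoc c (1 : (R ⧸ I)ᵐᵒᵖ) (rightGen J e)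
      rw [one_smul] at h
      rw [← h, ← op_one, ← op_smul, Algebra.smul_def, mul_one]
      rfl
    rw [h₁, RingHom.id_apply, ← Submodule.Quotient.mk_smul, TensorProduct.smul_tmul', ← h₂]
    exact (balanced_mk (k := k) (I := I) _ (rightGen J e) (algebraMap k R c) z).symm

theorem genTensor_surjective
    (hM : ∀ (r : R) (m : RightSpan J e),
      ((op (Ideal.Quotient.mk I r) • m : RightSpan J e) : R ⧸ J) = m * Ideal.Quotient.mk J r)
    (X : Ideal R) : Function.Surjective (genTensor k I J e X) := by
  intro t
  obtain ⟨t, rfl⟩ := Submodule.Quotient.mk_surjective _ t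
  induction t using TensorProduct.induction_on with
  | zero => exact ⟨0, map_zero _⟩
  | add s t hs ht =>
    obtain ⟨y, hy⟩ := hs
    obtain ⟨z, hz⟩ := ht
    exact ⟨y + z, by rw [map_add, hy, hz, Submodule.Quotient.mk_add]⟩
  | tmul m p =>
    obtain ⟨z, rfl⟩ := Submodule.Quotient.mk_surjective _ p
    obtain ⟨b, hb⟩ := Submodule.mem_span_singleton.1 m.2
    obtain ⟨r, hr⟩ := Ideal.Quotient.mk_surjective b.unop
    have hm : op (Ideal.Quotient.mk I r) • rightGen J e = m := by
      refine Subtype.ext ((hM r _).trans ?_)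
      rw [← hb, hr]
      rfl
    exact ⟨r • z, by rw [← hm, balanced_mk]; rfl⟩

theorem op_smul_rightGen_of_mem
    (hM : ∀ (r : R) (m : RightSpan J e),
      ((op (Ideal.Quotient.mk I r) • m : RightSpan J e) : R ⧸ J) = m * Ideal.Quotient.mk J r)
    {r : R} (h : e * r ∈ J) :
    op (Ideal.Quotient.mk I r) • rightGen J e = 0 := by
  refine Subtype.ext ((hM r _).trans ?_)
  exact Ideal.Quotient.eq_zero_iff_mem.2 h

theorem op_smul_rightGen_self
    (hM : ∀ (r : R) (m : RightSpan J e),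
      ((op (Ideal.Quotient.mk I r) • m : RightSpan J e) : R ⧸ J) = m * Ideal.Quotient.mk J r)
    (he : e * e = e) :
    op (Ideal.Quotient.mk I e) • rightGen J e = rightGen J e :=
  Subtype.ext ((hM e _).trans (congrArg (Ideal.Quotient.mk J) he))

variable (k I J e) in
/-- The multiplication map `e (R/J) ⊗ X / I X → R / J X`, `r ⊗ z ↦ r z`. -/
def tensorEval (hIJ : I ≤ J)
    (hM : ∀ (r : R) (m : RightSpan J e),
      ((op (Ideal.Quotient.mk I r) • m : RightSpan J e) : R ⧸ J) = m * Ideal.Quotient.mk J r)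
    (X : Ideal R) :
    BalancedTensor k (R ⧸ I) (RightSpan J e) (LayerModule I X) →ₗ[k] R ⧸ (J * X) := by
  -- right multiplication by `z`, and below its additive extensions to `X` and to `X / I X`
  let β (z : X) : (R ⧸ J) →ₗ[R] R ⧸ (J * X) :=
    Submodule.liftQ J (LinearMap.toSpanSingleton R (R ⧸ (J * X)) (Submodule.Quotient.mk (z : R)))
      fun r hr => (Submodule.Quotient.mk_eq_zero _).2 (Ideal.mul_mem_mul hr z.2)
  have hβ (z : X) (r : R) : β z (Ideal.Quotient.mk J r) = Submodule.Quotient.mk (r * z) := rfl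
  let γ : X →+ (R ⧸ J) →ₗ[R] R ⧸ (J * X) :=
    { toFun := β
      map_zero' := by
        ext
        exact (hβ 0 1).trans (congrArg _ (mul_zero _))
      map_add' := fun y z => by
        ext
        exact (hβ (y + z) 1).trans (congrArg _ (mul_add _ _ _)) }
  let δ : LayerModule I X →+ (R ⧸ J) →ₗ[R] R ⧸ (J * X) :=
    QuotientAddGroup.lift (I • ⊤ : Submodule R X).toAddSubgroup γ fun z hz => by
      replace hz : (z : R) ∈ I * X := (Submodule.mem_smul_top_iff I X z).1 hz
      ext
      refine (hβ z 1).trans ((Submodule.Quotient.mk_eq_zero _).2 ?_)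
      rw [one_mul]
      exact Ideal.mul_mono_left hIJ hz
  refine Submodule.liftQ _ (TensorProduct.AlgebraTensorModule.lift
    { toFun := fun m =>
        ({ toFun := fun p => δ p m
           map_zero' := by rw [map_zero, LinearMap.zero_apply]
           map_add' := fun p q => by rw [map_add, LinearMap.add_apply] } :
          LayerModule I X →+ R ⧸ (J * X)).toIntLinearMap
      map_add' := fun m m' => LinearMap.ext fun p => (δ p).map_add m m'
      map_smul' := fun c m => LinearMap.ext fun p => (δ p).map_smul_of_tower c (m : R ⧸ J) }) ?_
  refine Submodule.span_le.2 ?_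
  rintro _ ⟨m, s, p, rfl⟩
  obtain ⟨r, rfl⟩ := Ideal.Quotient.mk_surjective s
  obtain ⟨z, rfl⟩ := Submodule.Quotient.mk_surjective _ p
  obtain ⟨t, ht⟩ := Ideal.Quotient.mk_surjective (m : R ⧸ J)
  rw [SetLike.mem_coe, LinearMap.mem_ker, map_sub, sub_eq_zero]
  change β z (op (Ideal.Quotient.mk I r) • m : RightSpan J e) = β (r • z) m
  rw [hM, ← ht, ← map_mul, hβ, hβ, mul_assoc]
  rfl

theorem tensorEval_genTensor (hIJ : I ≤ J)
    (hM : ∀ (r : R) (m : RightSpan J e),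
      ((op (Ideal.Quotient.mk I r) • m : RightSpan J e) : R ⧸ J) = m * Ideal.Quotient.mk J r)
    {X : Ideal R} (z : X) :
    tensorEval k I J e hIJ hM X (genTensor k I J e X z) = Submodule.Quotient.mk (e * z) := rfl

/-- `e ⊗ z = 0` if and only if `e z ∈ J X`: one direction evaluates the tensor in `R / J X`, the
other uses `e ⊗ z = e ⊗ e z` and `e ⊗ r z = e r ⊗ z = 0` for `r ∈ J`. -/
theorem genTensor_eq_zero_iff
    (hM : ∀ (r : R) (m : RightSpan J e),
      ((op (Ideal.Quotient.mk I r) • m : RightSpan J e) : R ⧸ J) = m * Ideal.Quotient.mk J r)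
    (hIJ : I ≤ J) (he : e * e = e) {X : Ideal R} (z : X) :
    genTensor k I J e X z = 0 ↔ e * z ∈ J * X := by
  constructor
  · intro h
    have h' := tensorEval_genTensor (k := k) hIJ hM z
    rw [h, map_zero] at h'
    exact (Submodule.Quotient.mk_eq_zero _).1 h'.symm
  · intro hz
    have h : genTensor k I J e X (e • z) = genTensor k I J e X z := by
      have := balanced_mk (k := k) (I := I) _ (rightGen J e) e z
      rw [op_smul_rightGen_self hM he] at this
      exact this.symm
    rw [← h]
    refine Submodule.smul_induction_on (p := fun m => genTensor k I J e X m = 0)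
      ((Submodule.mem_smul_top_iff J X (e • z)).2 hz) (fun r hr m _ => ?_) fun m m' hm hm' => ?_
    · have := balanced_mk (k := k) (I := I) _ (rightGen J e) r m
      rw [op_smul_rightGen_of_mem hM (J.mul_mem_left e hr), TensorProduct.zero_tmul] at this
      exact this.symm
    · rw [map_add, hm, hm', add_zero]

end Tensor

/-! ### Tor over a quotient by a projective ideal -/

section Chain

variable {R : Type a} [Ring R] (I J : Ideal R)

/-- The chain of ideals `R, J, I, I J, I², I² J, …`. -/
def idealChain : ℕ → Ideal R
  | 0 => ⊤
  | 1 => J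
  | n + 2 => I * idealChain n

theorem idealChain_add_two (n : ℕ) : idealChain I J (n + 2) = I * idealChain I J n := by
  rw [idealChain]

theorem idealChain_even (n : ℕ) [I.IsTwoSided] : idealChain I J (2 * n) = I ^ n := by
  induction n with
  | zero => rw [Submodule.pow_zero, Ideal.one_eq_top]; rfl
  | succ n ih =>
    rw [Nat.mul_succ, idealChain_add_two, ih]
    rcases eq_or_ne n 0 with rfl | hn
    · rw [Submodule.pow_zero, Submodule.pow_one, Ideal.one_eq_top, Ideal.mul_top]
    · rw [Submodule.pow_succ' _ hn]

theorem idealChain_odd (n : ℕ) [I.IsTwoSided] : idealChain I J (2 * n + 1) = I ^ n * J := by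
  induction n with
  | zero => rw [Submodule.pow_zero, Ideal.one_eq_top, Ideal.top_mul]; rfl
  | succ n ih =>
    rw [Nat.mul_succ, Nat.add_right_comm, idealChain_add_two, ih, ← mul_assoc]
    rcases eq_or_ne n 0 with rfl | hn
    · rw [Submodule.pow_zero, Submodule.pow_one, Ideal.one_eq_top, Ideal.mul_top]
    · rw [Submodule.pow_succ' _ hn]

variable [I.IsTwoSided]

theorem idealChain_succ_le (hIJ : I ≤ J) : ∀ n, idealChain I J (n + 1) ≤ idealChain I J n
  | 0 => le_top
  | 1 => (idealChain_add_two I J 0).trans_le (Ideal.mul_le_left.trans hIJ)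
  | n + 2 => by
    rw [idealChain_add_two, idealChain_add_two]
    exact Ideal.mul_mono_right (idealChain_succ_le hIJ n)

variable [J.IsTwoSided]

instance idealChain_isTwoSided : ∀ n, (idealChain I J n).IsTwoSided
  | 0 => inferInstanceAs (⊤ : Ideal R).IsTwoSided
  | 1 => inferInstanceAs J.IsTwoSided
  | n + 2 => by
    have := idealChain_isTwoSided n
    rw [idealChain_add_two]
    infer_instance

instance projective_idealChain [Module.Projective R I] [Module.Projective R J] :
    ∀ n, Module.Projective R (idealChain I J n)
  | 0 => Module.Projective.of_equiv' (Submodule.topEquiv (R := R) (M := R)).symm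
  | 1 => inferInstanceAs (Module.Projective R J)
  | n + 2 => by
    have := projective_idealChain n
    rw [idealChain_add_two]
    exact projective_mul I _

end Chain

section Tor

variable {k : Type u} [CommRing k] {R : Type a} [Ring R] [Algebra k R]
  {I J : Ideal R} [I.IsTwoSided] [J.IsTwoSided] {e f : R}

variable (J f) in
/-- The left ideal `(R/J) f`. -/
abbrev LeftSpan : Type a := Submodule.span (R ⧸ J) {Ideal.Quotient.mk J f}

/-- The augmentation `R f / I f → (R/J) f`. -/
def augmentation [Module (R ⧸ I) (LeftSpan J f)]
    (hIJ : I ≤ J)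
    (hN : ∀ (r : R) (m : LeftSpan J f),
      ((Ideal.Quotient.mk I r • m : LeftSpan J f) : R ⧸ J) =
        Ideal.Quotient.mk J r * m) :
    LayerModule I (fixedIdeal f (⊤ : Ideal R)) →ₗ[R ⧸ I]
      LeftSpan J f :=
  let g : fixedIdeal f (⊤ : Ideal R) →+ LeftSpan J f :=
    { toFun := fun z => ⟨Ideal.Quotient.mk J z, Submodule.mem_span_singleton.2
        ⟨Ideal.Quotient.mk J z, (map_mul _ _ _).symm.trans (congrArg _ z.2.2)⟩⟩
      map_zero' := rfl
      map_add' := fun _ _ => rfl }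
  extendQuotient I (QuotientAddGroup.lift (I • ⊤ : Submodule R _).toAddSubgroup g fun z hz =>
    Subtype.ext (Ideal.Quotient.eq_zero_iff_mem.2
      (hIJ (Ideal.mul_le_left ((Submodule.mem_smul_top_iff I _ z).1 hz))))) fun r m => by
    obtain ⟨z, rfl⟩ := Submodule.Quotient.mk_surjective _ m
    exact Subtype.ext ((map_mul _ _ _).trans (hN r (g z)).symm)

theorem augmentation_mk [Module (R ⧸ I) (LeftSpan J f)]
    (hIJ : I ≤ J)
    (hN : ∀ (r : R) (m : LeftSpan J f),
      ((Ideal.Quotient.mk I r • m : LeftSpan J f) : R ⧸ J) =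
        Ideal.Quotient.mk J r * m) (z : fixedIdeal f (⊤ : Ideal R)) :
    (augmentation hIJ hN (Submodule.Quotient.mk z) : R ⧸ J) = Ideal.Quotient.mk J z := rfl

theorem augmentation_surjective [Module (R ⧸ I) (LeftSpan J f)]
    (hIJ : I ≤ J)
    (hN : ∀ (r : R) (m : LeftSpan J f),
      ((Ideal.Quotient.mk I r • m : LeftSpan J f) : R ⧸ J) =
        Ideal.Quotient.mk J r * m) (hf : f * f = f) :
    Function.Surjective (augmentation hIJ hN) := by
  rintro ⟨m, hm⟩
  obtain ⟨s, rfl⟩ := Submodule.mem_span_singleton.1 hm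
  obtain ⟨r, rfl⟩ := Ideal.Quotient.mk_surjective s
  exact ⟨Submodule.Quotient.mk ⟨r * f, mul_mem_fixedIdeal hf trivial⟩, rfl⟩

theorem layerMap_augmentation_exact
    [Module (R ⧸ I) (LeftSpan J f)]
    (hIJ : I ≤ J)
    (hN : ∀ (r : R) (m : LeftSpan J f),
      ((Ideal.Quotient.mk I r • m : LeftSpan J f) : R ⧸ J) =
        Ideal.Quotient.mk J r * m) (h : fixedIdeal f J ≤ fixedIdeal f ⊤) :
    Function.Exact (layerMap I h) (augmentation hIJ hN) := by
  intro m
  obtain ⟨z, rfl⟩ := Submodule.Quotient.mk_surjective _ m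
  rw [← Submodule.coe_eq_zero, augmentation_mk, Ideal.Quotient.eq_zero_iff_mem]
  constructor
  · intro hz
    exact ⟨Submodule.Quotient.mk ⟨z, hz, z.2.2⟩, rfl⟩
  · rintro ⟨m, hm⟩
    obtain ⟨y, rfl⟩ := Submodule.Quotient.mk_surjective _ m
    have h₁ := augmentation_mk hIJ hN z
    rw [← hm] at h₁
    exact Ideal.Quotient.eq_zero_iff_mem.1 (h₁.symm.trans (Ideal.Quotient.eq_zero_iff_mem.2 y.2.1))

/-- The submodule `e (X/Y) f` of `R/Y`. -/
abbrev idempotentCorner (k : Type u) [CommRing k] {R : Type a} [Ring R] [Algebra k R] (e f : R)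
    (X Y : Ideal R) : Submodule k (R ⧸ Y) :=
  (X.restrictScalars k).map
    ((Submodule.mkQ Y).restrictScalars k ∘ₗ LinearMap.mulLeftRight k (e, f))

/-- If `I ≤ J` are two-sided ideals, projective as left modules, and `Y` is the chain
`R, J, I, I J, …`, then `Tor_{n+1}` over `R/I` of `e (R/J)` and `(R/J) f` is the corner
`e (Y (n + 1) ∩ J Y n) / (Y (n + 2) + J Y (n + 1)) f`. -/
theorem nonempty_torModule_linearEquiv_idempotentCorner
    [Module (R ⧸ I)ᵐᵒᵖ (RightSpan J e)] [IsScalarTower k (R ⧸ I)ᵐᵒᵖ (RightSpan J e)]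
    (hM : ∀ (r : R) (m : RightSpan J e),
      ((op (Ideal.Quotient.mk I r) • m : RightSpan J e) : R ⧸ J) = m * Ideal.Quotient.mk J r)
    [Module (R ⧸ I) (LeftSpan J f)]
    (hN : ∀ (r : R) (m : LeftSpan J f),
      ((Ideal.Quotient.mk I r • m : LeftSpan J f) : R ⧸ J) =
        Ideal.Quotient.mk J r * m)
    (hIJ : I ≤ J) (he : e * e = e) (hf : f * f = f)
    [Module.Projective R I] [Module.Projective R J] (n : ℕ) {C D : Ideal R}
    (hC : C = idealChain I J (n + 1) ⊓ J * idealChain I J n)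
    (hD : D = idealChain I J (n + 2) ⊔ J * idealChain I J (n + 1)) :
    Nonempty (TorModule k (R ⧸ I) (RightSpan J e)
      (LeftSpan J f) (n + 1) ≃ₗ[k]
        idempotentCorner k e f C D) := by
  subst hC hD
  let X (n : ℕ) : Ideal R := fixedIdeal f (idealChain I J n)
  have hle (n : ℕ) : X (n + 1) ≤ X n := fun z hz => ⟨idealChain_succ_le I J hIJ n hz.1, hz.2⟩
  have hX (n : ℕ) : X (n + 2) = I * X n := by
    rw [mul_fixedIdeal hf, ← idealChain_add_two]
  have hJX (n : ℕ) : J * X n = fixedIdeal f (J * idealChain I J n) := mul_fixedIdeal hf _ _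
  have hproj (n : ℕ) : Module.Projective R (X n) := projective_fixedIdeal hf _
  let d (n : ℕ) : LayerModule I (X (n + 1)) →ₗ[R ⧸ I] LayerModule I (X n) := layerMap I (hle n)
  -- the elements of `X (n + 1)` whose class is a cycle
  let W : Submodule k (X (n + 1)) :=
    LinearMap.ker (genTensor k I J e (X n) ∘ₗ (Submodule.inclusion (hle n)).restrictScalars k)
  have hW (z : X (n + 1)) : z ∈ W ↔ e * z ∈ J * X n :=
    genTensor_eq_zero_iff hM hIJ he (Submodule.inclusion (hle n) z)
  -- the map from these elements to the quotient that contains the corner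
  let T : X (n + 1) →ₗ[k] R ⧸ (idealChain I J (n + 2) ⊔ J * idealChain I J (n + 1)) :=
    ((Submodule.mkQ _).restrictScalars k ∘ₗ LinearMap.mulLeftRight k (e, f)) ∘ₗ
      (X (n + 1)).subtype.restrictScalars k
  have hT (z : X (n + 1)) : T z = Submodule.Quotient.mk (e * z) :=
    congrArg Submodule.Quotient.mk ((mul_assoc _ _ _).trans (congrArg (e * ·) z.2.2))
  have hTW (z : W) : (T ∘ₗ W.subtype) z ∈ idempotentCorner k e f
      (idealChain I J (n + 1) ⊓ J * idealChain I J n)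
      (idealChain I J (n + 2) ⊔ J * idealChain I J (n + 1)) := by
    have hz := (hW z).1 z.2
    rw [hJX] at hz
    refine ⟨e * z, ⟨Ideal.mul_mem_left _ e z.1.2.1, hz.1⟩, ?_⟩
    refine congrArg Submodule.Quotient.mk ?_
    change e * (e * z) * f = e * z * f
    rw [← mul_assoc, he]
  refine nonempty_torModule_linearEquiv (P := fun n => LayerModule I (X n)) k (RightSpan J e) d
    (augmentation hIJ hN)
    (fun n => layerMap_exact I _ _ (hX n)) (layerMap_augmentation_exact hIJ hN _)
    (augmentation_surjective hIJ hN hf) n (genTensor k I J e (X (n + 1)) ∘ₗ W.subtype)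
    (fun z => z.2) ?_ ((T ∘ₗ W.subtype).codRestrict _ hTW) ?_ ?_
  · -- every cycle is the class of an element of `W`, with no boundary needed
    intro t ht
    obtain ⟨z, rfl⟩ := genTensor_surjective hM _ t
    exact ⟨⟨z, ht⟩, 0, by rw [map_zero, add_zero]; rfl⟩
  · rintro ⟨_, z, ⟨hz, hz'⟩, rfl⟩
    have hzf : e * (z * f) ∈ J * X n := by
      rw [hJX]
      exact Ideal.mul_mem_left _ e (mul_mem_fixedIdeal hf hz')
    refine ⟨⟨⟨z * f, mul_mem_fixedIdeal hf hz⟩, (hW _).2 hzf⟩, Subtype.ext ?_⟩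
    exact (hT _).trans (congrArg Submodule.Quotient.mk (mul_assoc _ _ _).symm)
  · intro z
    have key (y : X (n + 2)) : balancedMap k (R ⧸ I) (RightSpan J e) (d (n + 1))
        (genTensor k I J e _ y) = genTensor k I J e _ (z : X (n + 1)) ↔
          e * (y - z : R) ∈ J * X (n + 1) := by
      refine Iff.trans ?_ (genTensor_eq_zero_iff (k := k) hM hIJ he
        (Submodule.inclusion (hle _) y - z.1))
      rw [map_sub, sub_eq_zero]
      rfl
    rw [← Submodule.coe_eq_zero]
    refine (Iff.of_eq (congrArg (· = 0) (hT z))).trans ((Submodule.Quotient.mk_eq_zero _).trans ?_)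
    constructor
    · intro h
      obtain ⟨y, hy, t, ht, h⟩ := Submodule.mem_sup.1 h
      -- multiplying by `f` moves the summands `y` and `t` into `X (n + 2)` and `J X (n + 1)`
      refine ⟨genTensor k I J e _ ⟨y * f, mul_mem_fixedIdeal hf hy⟩, (key _).2 ?_⟩
      have : e * (y * f - z) = -(e * (t * f)) := by
        have h' : e * (e * z.1.1 * f) = e * ((y + t) * f) := by rw [h]
        rw [mul_assoc e z.1.1 f, z.1.2.2, ← mul_assoc, he, add_mul, mul_add] at h'
        rw [mul_sub, h']
        abel
      rw [this, hJX]
      exact neg_mem (Ideal.mul_mem_left _ _ (mul_mem_fixedIdeal hf ht))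
    · rintro ⟨t, ht⟩
      obtain ⟨y, rfl⟩ := genTensor_surjective hM _ t
      have h := (key y).1 ht
      rw [hJX] at h
      have : e * z.1.1 = e * y - e * (y - z) := by rw [mul_sub]; abel
      rw [this]
      exact sub_mem (Submodule.mem_sup_left (Ideal.mul_mem_left _ e y.2.1))
        (Submodule.mem_sup_right h.1)

end Tor

/-! ### Left ideals of a path algebra -/

section Vertices

variable (k : Type u) [CommRing k] {Q : Type v} [Quiver.{w} Q]

theorem vertex_mul_ofPath {s m : Q} (p : Quiver.Path s m) :
    vertex k m * ofPath k ⟨s, m, p⟩ = ofPath k ⟨s, m, p⟩ := by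
  rw [vertex, ofPath_mul_of_eq, Quiver.Path.comp_nil]

theorem ofPath_mul_vertex {s m : Q} (p : Quiver.Path s m) :
    ofPath k ⟨s, m, p⟩ * vertex k s = ofPath k ⟨s, m, p⟩ := by
  rw [vertex, ofPath_mul_of_eq, Quiver.Path.nil_comp]

theorem vertex_mul_self (x : Q) : vertex k x * vertex k x = vertex k x :=
  vertex_mul_ofPath k _

theorem vertex_mul_of_ne {x y : Q} (h : x ≠ y) : vertex k x * vertex k y = 0 :=
  ofPath_mul_of_ne k (p := ⟨x, x, _⟩) (q := ⟨y, y, _⟩) h.symm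

theorem arrow_mul_ofPath {s m n : Q} (p : Quiver.Path s m) (b : m ⟶ n) :
    arrow k b * ofPath k ⟨s, m, p⟩ = ofPath k ⟨s, n, p.cons b⟩ :=
  ofPath_mul_of_eq k _ _

theorem vertex_mul_arrow {m n : Q} (b : m ⟶ n) : vertex k n * arrow k b = arrow k b :=
  vertex_mul_ofPath k _

theorem arrow_mul_vertex {m n : Q} (b : m ⟶ n) : arrow k b * vertex k m = arrow k b :=
  ofPath_mul_vertex k _

instance free_pathAlgebra : Module.Free k (PathAlgebra k Q) :=
  inferInstanceAs (Module.Free k (AllPaths Q →₀ k))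

/-- The linear map out of the path algebra with prescribed values on paths. -/
def liftPaths {F : Type*} [AddCommGroup F] [Module k F] (h : AllPaths Q → F) :
    PathAlgebra k Q →ₗ[k] F :=
  (Finsupp.linearCombination k h : (AllPaths Q →₀ k) →ₗ[k] F)

theorem liftPaths_ofPath {F : Type*} [AddCommGroup F] [Module k F] (h : AllPaths Q → F)
    (p : AllPaths Q) : liftPaths k h (ofPath k p) = h p :=
  (Finsupp.linearCombination_single k 1 p).trans (one_smul k _)

end Vertices

section Splitting

variable {k : Type u} [CommRing k] {Q : Type v} [Quiver.{w} Q] [Fintype Q]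
  {F : Type*} [AddCommGroup F] [Module k F] [Module (PathAlgebra k Q) F]
  {X : Ideal (PathAlgebra k Q)}

/-- The correction term that makes a `k`-linear section `t` over `X` commute with arrows, defined
by recursion on the length of a path: appending an arrow `b` to `p` adds the defect
`b t(p) - t(b f(t(p)))`. -/
def pathCorrection (f : F →ₗ[PathAlgebra k Q] X) (t : PathAlgebra k Q →ₗ[k] F) {s : Q} :
    ∀ {m : Q}, Quiver.Path s m → F
  | _, .nil => 0
  | _, .cons p b => arrow k b • pathCorrection f t p + (arrow k b • t (ofPath k ⟨_, _, p⟩) -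
      t (arrow k b * f (t (ofPath k ⟨_, _, p⟩))))

theorem vertex_smul_pathCorrection (f : F →ₗ[PathAlgebra k Q] X) (t : PathAlgebra k Q →ₗ[k] F)
    (ht : ∀ x z, t (vertex k x * z) = vertex k x • t z) {s m : Q} (p : Quiver.Path s m) :
    vertex k m • pathCorrection f t p = pathCorrection f t p := by
  cases p with
  | nil => exact smul_zero _
  | cons p b =>
    rw [pathCorrection, smul_add, smul_sub, smul_smul, smul_smul, vertex_mul_arrow, ← ht,
      ← mul_assoc, vertex_mul_arrow]

variable [IsScalarTower k (PathAlgebra k Q) F]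

/-- A `k`-linear section over `X` can be made to commute with the idempotents `ε_v`. -/
theorem exists_vertex_equivariant (f : F →ₗ[PathAlgebra k Q] X) (t : PathAlgebra k Q →ₗ[k] F)
    (ht : ∀ z ∈ X, (f (t z) : PathAlgebra k Q) = z) :
    ∃ t' : PathAlgebra k Q →ₗ[k] F, (∀ z ∈ X, (f (t' z) : PathAlgebra k Q) = z) ∧
      ∀ x z, t' (vertex k x * z) = vertex k x • t' z := by
  classical
  -- averaging over the idempotents: `t' z = ∑ ε_v t (ε_v z)`
  let t' : PathAlgebra k Q →ₗ[k] F := ∑ x : Q, Algebra.lsmul k k F (vertex k x) ∘ₗ t ∘ₗ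
    LinearMap.mulLeft k (vertex k x)
  have ht' (z) : t' z = ∑ x : Q, vertex k x • t (vertex k x * z) := by
    simp [t', LinearMap.sum_apply]
  refine ⟨t', fun z hz => ?_, fun x z => ?_⟩
  · rw [ht', map_sum, AddSubmonoidClass.coe_finsetSum]
    conv_rhs => rw [← one_mul z, one_def, Finset.sum_mul]
    refine Finset.sum_congr rfl fun x _ => ?_
    rw [map_smul, Submodule.coe_smul, ht _ (X.mul_mem_left _ hz), smul_eq_mul, ← mul_assoc,
      vertex_mul_self]
  · rw [ht', ht', Finset.sum_eq_single x, Finset.smul_sum, Finset.sum_eq_single x]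
    · rw [← mul_assoc, vertex_mul_self, smul_smul, vertex_mul_self]
    · intro y _ hy
      rw [smul_smul, vertex_mul_of_ne k hy.symm, zero_smul]
    · simp
    · intro y _ hy
      rw [← mul_assoc, vertex_mul_of_ne k hy, zero_mul, map_zero, smul_zero]
    · simp

/-- The linear extension of the correction term to the path algebra. -/
def correction (f : F →ₗ[PathAlgebra k Q] X) (t : PathAlgebra k Q →ₗ[k] F) :
    PathAlgebra k Q →ₗ[k] F :=
  liftPaths k fun p => pathCorrection f t p.2.2

/-- The correction term takes its values in the kernel of `f`. -/
theorem map_correction (f : F →ₗ[PathAlgebra k Q] X) (t : PathAlgebra k Q →ₗ[k] F)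
    (ht : ∀ z ∈ X, (f (t z) : PathAlgebra k Q) = z) (z : PathAlgebra k Q) :
    f (correction f t z) = 0 := by
  have hpath {s m : Q} (p : Quiver.Path s m) : f (pathCorrection f t p) = 0 := by
    induction p with
    | nil => exact map_zero f
    | cons p b ih =>
      rw [pathCorrection, map_add, map_smul, ih, smul_zero, zero_add, map_sub, map_smul,
        sub_eq_zero]
      exact Subtype.ext (ht _ (X.mul_mem_left _ (Submodule.coe_mem _))).symm
  refine induction_on k z ?_ (fun z z' h h' => ?_) fun c p => ?_
  · rw [map_zero, map_zero]
  · rw [map_add, map_add, h, h', add_zero]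
  · rw [map_smul, correction, liftPaths_ofPath, ← algebraMap_smul (PathAlgebra k Q), map_smul,
      hpath, smul_zero]

theorem correction_vertex_mul (f : F →ₗ[PathAlgebra k Q] X) (t : PathAlgebra k Q →ₗ[k] F)
    (ht : ∀ x z, t (vertex k x * z) = vertex k x • t z)
    (x : Q) (z : PathAlgebra k Q) :
    correction f t (vertex k x * z) = vertex k x • correction f t z := by
  refine induction_on k z ?_ (fun z z' h h' => ?_) fun c p => ?_
  · rw [mul_zero, map_zero, smul_zero]
  · rw [mul_add, map_add, map_add, h, h', smul_add]
  obtain ⟨s, m, p⟩ := p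
  rw [mul_smul'', map_smul, map_smul, smul_comm]
  congr 1
  have h := vertex_smul_pathCorrection f t ht p
  by_cases hx : m = x
  · subst hx
    rw [vertex_mul_ofPath, correction, liftPaths_ofPath, h]
  · rw [← vertex_mul_ofPath k p, ← mul_assoc, vertex_mul_of_ne k (Ne.symm hx), zero_mul, map_zero,
      vertex_mul_ofPath, correction, liftPaths_ofPath, ← h, smul_smul,
      vertex_mul_of_ne k (Ne.symm hx), zero_smul]

/-- If `t` commutes with the `ε_v`, the recursion for the correction term on paths holds for all
elements of the path algebra: when `b` cannot be appended to a path, all terms vanish. -/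
theorem correction_arrow_mul (f : F →ₗ[PathAlgebra k Q] X) (t : PathAlgebra k Q →ₗ[k] F)
    (ht : ∀ x z, t (vertex k x * z) = vertex k x • t z)
    {x y : Q} (b : x ⟶ y) (z : PathAlgebra k Q) :
    correction f t (arrow k b * z) =
      arrow k b • correction f t z + (arrow k b • t z - t (arrow k b * f (t z))) := by
  refine induction_on k z ?_ (fun z z' h h' => ?_) fun c p => ?_
  · simp
  · rw [mul_add, map_add, h, h']
    simp only [map_add, smul_add, Submodule.coe_add, mul_add]
    abel
  obtain ⟨s, m, p⟩ := p
  have hf (d : k) (w : F) : (f (d • w) : PathAlgebra k Q) = d • (f w : PathAlgebra k Q) := by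
    rw [← algebraMap_smul (PathAlgebra k Q), map_smul, Submodule.coe_smul, algebraMap_smul]
  rw [mul_smul'', map_smul, map_smul, map_smul, hf, mul_smul'', map_smul, smul_comm _ c,
    smul_comm _ c, ← smul_sub, ← smul_add]
  congr 1
  by_cases hx : m = x
  · subst hx
    rw [arrow_mul_ofPath, correction, liftPaths_ofPath, liftPaths_ofPath]
    rfl
  · have h₀ (w : F) : arrow k b • vertex k m • w = 0 := by
      rw [smul_smul, ← arrow_mul_vertex k b, mul_assoc, vertex_mul_of_ne k (Ne.symm hx), mul_zero,
        zero_smul]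
    have h₁ (w : PathAlgebra k Q) : arrow k b * (vertex k m * w) = 0 := by
      rw [← mul_assoc, ← arrow_mul_vertex k b, mul_assoc (arrow k b),
        vertex_mul_of_ne k (Ne.symm hx), mul_zero, zero_mul]
    rw [← vertex_mul_ofPath k p, h₁, correction_vertex_mul f t ht, ht, map_smul,
      Submodule.coe_smul, smul_eq_mul, h₀, h₀, h₁, map_zero]
    simp

/-- A linear map onto a left ideal `X` of the path algebra which has a `k`-linear section (extended
to the whole path algebra) has a linear section. -/
theorem exists_section (f : F →ₗ[PathAlgebra k Q] X) (t : PathAlgebra k Q →ₗ[k] F)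
    (ht : ∀ z ∈ X, (f (t z) : PathAlgebra k Q) = z) :
    ∃ s : X →ₗ[PathAlgebra k Q] F, f ∘ₗ s = LinearMap.id := by
  obtain ⟨t, ht, hv⟩ := exists_vertex_equivariant f t ht
  -- the sum commutes on `X` with all paths, hence is linear there
  let g : PathAlgebra k Q →ₗ[k] F := t + correction f t
  have hg (z) : g z = t z + correction f t z := rfl
  have hvertex (x : Q) (z) : g (vertex k x * z) = vertex k x • g z := by
    rw [hg, hg, hv, correction_vertex_mul f t hv, smul_add]
  have harrow {x y : Q} (b : x ⟶ y) (z) (hz : z ∈ X) : g (arrow k b * z) = arrow k b • g z := by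
    rw [hg, hg, correction_arrow_mul f t hv, ht z hz, smul_add]
    abel
  have hpath {s m : Q} (p : Quiver.Path s m) (z) (hz : z ∈ X) :
      g (ofPath k ⟨s, m, p⟩ * z) = ofPath k ⟨s, m, p⟩ • g z := by
    induction p with
    | nil => exact hvertex s z
    | cons p b ih =>
      rw [← arrow_mul_ofPath, mul_assoc, harrow b _ (X.mul_mem_left _ hz), ih, smul_smul]
  refine ⟨
    { toFun := fun z => g z
      map_add' := fun z z' => map_add g _ _
      map_smul' := fun r z => ?_ }, LinearMap.ext fun z => Subtype.ext ?_⟩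
  · rw [RingHom.id_apply, Submodule.coe_smul, smul_eq_mul]
    refine induction_on k r ?_ (fun r r' h h' => ?_) fun c p => ?_
    · rw [zero_mul, map_zero, zero_smul]
    · rw [add_mul, map_add, h, h', add_smul]
    · rw [smul_mul', map_smul, hpath _ _ z.2, smul_assoc]
  · change (f (g z) : PathAlgebra k Q) = z
    rw [hg, map_add, map_correction f t ht, add_zero, ht _ z.2]

/-- The path algebra is hereditary relative to `k`: a left ideal `X` with `kQ/X` projective over `k`
is a projective left module. -/
theorem projective_of_projective_quotient (X : Ideal (PathAlgebra k Q))
    [Module.Projective k (PathAlgebra k Q ⧸ X)] : Module.Projective (PathAlgebra k Q) X := by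
  obtain ⟨σ, hσ⟩ := ((Submodule.mkQ X).restrictScalars k).exists_rightInverse_of_surjective
    (LinearMap.range_eq_top.2 (Submodule.mkQ_surjective X))
  have hσ' (r : PathAlgebra k Q ⧸ X) : Submodule.Quotient.mk (σ r) = r := LinearMap.congr_fun hσ r
  -- the `k`-linear retraction onto `X`
  let ρ : PathAlgebra k Q →ₗ[k] X.restrictScalars k :=
    (LinearMap.id - σ ∘ₗ (Submodule.mkQ X).restrictScalars k).codRestrict (X.restrictScalars k)
      fun r => (Submodule.Quotient.eq X).1 (hσ' (Submodule.Quotient.mk r)).symm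
  let f : (X →₀ PathAlgebra k Q) →ₗ[PathAlgebra k Q] X := Finsupp.linearCombination _ id
  have hf : Function.Surjective f := fun z => ⟨Finsupp.single z 1, by simp [f]⟩
  obtain ⟨t, ht⟩ := Module.projective_lifting_property
    (f.restrictScalars k : (X →₀ PathAlgebra k Q) →ₗ[k] X.restrictScalars k) ρ hf
  obtain ⟨s, hs⟩ := exists_section f t fun z hz => by
    refine (congrArg Subtype.val (LinearMap.congr_fun ht z)).trans ?_
    change z - σ (Submodule.Quotient.mk z) = z
    rw [(Submodule.Quotient.mk_eq_zero X).2 hz, map_zero, sub_zero]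
  exact Module.Projective.of_split s f hs

end Splitting

/-! ### The arrow ideal -/

section ArrowIdeal

variable (k : Type u) [CommRing k] (Q : Type v) [Quiver.{w} Q] [Fintype Q]

variable {k Q} in
/-- Induction over the elements of the arrow ideal. -/
theorem arrowIdeal_induction {P : PathAlgebra k Q → Prop} {z : PathAlgebra k Q}
    (hz : z ∈ arrowIdeal k Q) (h₀ : P 0) (hadd : ∀ z z', P z → P z' → P (z + z'))
    (hsmul : ∀ (c : k) z, P z → P (c • z))
    (hpath : ∀ {s m : Q} (p : Quiver.Path s m), 0 < p.length → P (ofPath k ⟨s, m, p⟩)) : P z := by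
  change z ∈ Submodule.span k _ at hz
  refine Submodule.span_induction (fun z hz => ?_) h₀ (fun x y _ _ => hadd x y)
    (fun c x _ => hsmul c x) hz
  obtain ⟨⟨s, m, p⟩, hp, rfl⟩ := hz
  exact hpath p hp

variable {Q} in
theorem ofPath_mem_arrowIdeal {s m : Q} (p : Quiver.Path s m) (hp : 0 < p.length) :
    ofPath k ⟨s, m, p⟩ ∈ arrowIdeal k Q :=
  Submodule.subset_span (R := k) ⟨⟨s, m, p⟩, hp, rfl⟩

/-- `kQ/J` is a direct summand of `kQ` over `k`, complemented by the paths of positive length. -/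
instance projective_quotient_arrowIdeal :
    Module.Projective k (PathAlgebra k Q ⧸ arrowIdeal k Q) := by
  classical
  -- the projection onto the span of the empty paths, which kills `J`
  let τ : PathAlgebra k Q →ₗ[k] PathAlgebra k Q :=
    liftPaths k fun p => if p.2.2.length = 0 then ofPath k p else 0
  have hτ : (arrowIdeal k Q).restrictScalars k ≤ LinearMap.ker τ := by
    intro z hz
    refine arrowIdeal_induction (P := fun z => τ z = 0) hz (map_zero _) (fun z z' h h' => ?_)
      (fun c z h => ?_) fun p hp => ?_
    · rw [map_add, h, h', add_zero]
    · rw [map_smul, h, smul_zero]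
    · exact (liftPaths_ofPath k _ _).trans (if_neg hp.ne')
  let i : (PathAlgebra k Q ⧸ arrowIdeal k Q) →ₗ[k] PathAlgebra k Q :=
    ((arrowIdeal k Q).restrictScalars k).liftQ τ hτ ∘ₗ
      (Submodule.Quotient.restrictScalarsEquiv k (arrowIdeal k Q)).symm.toLinearMap
  refine Module.Projective.of_split i ((Submodule.mkQ (arrowIdeal k Q)).restrictScalars k)
    (LinearMap.ext fun z => ?_)
  obtain ⟨z, rfl⟩ := Submodule.Quotient.mk_surjective _ z
  change Submodule.Quotient.mk (τ z) = Submodule.Quotient.mk z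
  refine induction_on k z (by rw [map_zero]) (fun z z' h h' => ?_) fun c p => ?_
  · rw [map_add, Submodule.Quotient.mk_add, h, h', Submodule.Quotient.mk_add]
  · rw [map_smul, Submodule.Quotient.mk_smul, Submodule.Quotient.mk_smul]
    congr 1
    refine (congrArg _ (liftPaths_ofPath k _ _)).trans ?_
    obtain ⟨s, m, p⟩ := p
    split_ifs with hp
    · rfl
    · exact ((Submodule.Quotient.mk_eq_zero _).2
        (ofPath_mem_arrowIdeal k p (Nat.pos_of_ne_zero hp))).symm

theorem arrowIdeal_sq : arrowIdeal k Q ^ 2 = arrowIdeal k Q * arrowIdeal k Q := by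
  rw [Submodule.pow_succ, Submodule.pow_one]

variable {Q}

/-- The coefficient of a path in an element of the path algebra. -/
def coeff (p : AllPaths Q) : PathAlgebra k Q →ₗ[k] k :=
  (Finsupp.lapply p : (AllPaths Q →₀ k) →ₗ[k] k)

theorem coeff_ofPath_self (p : AllPaths Q) : coeff k p (ofPath k p) = 1 :=
  Finsupp.single_eq_same

theorem coeff_ofPath_of_ne {p q : AllPaths Q} (h : p ≠ q) : coeff k p (ofPath k q) = 0 :=
  Finsupp.single_eq_of_ne h

/-- `J²` is spanned by paths of length at least two, so coefficients at arrows vanish on it. -/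
theorem coeff_arrow_of_mem_sq {x y : Q} (b : x ⟶ y) {z : PathAlgebra k Q}
    (hz : z ∈ arrowIdeal k Q ^ 2) : coeff k ⟨x, y, b.toPath⟩ z = 0 := by
  rw [arrowIdeal_sq] at hz
  refine Submodule.smul_induction_on (p := fun z => coeff k ⟨x, y, b.toPath⟩ z = 0) hz
    (fun z hz z' hz' => ?_) fun z z' h h' => ?_
  swap
  · rw [map_add, h, h', add_zero]
  rw [smul_eq_mul]
  refine arrowIdeal_induction (P := fun z => coeff k ⟨x, y, b.toPath⟩ (z * z') = 0) hz ?_ ?_ ?_ ?_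
  · rw [zero_mul, map_zero]
  · intro z₁ z₂ h h'
    rw [add_mul, map_add, h, h', add_zero]
  · intro c z h
    rw [smul_mul', map_smul, h, smul_zero]
  intro s m p hp
  refine arrowIdeal_induction (P := fun z' => coeff k ⟨x, y, b.toPath⟩
    (ofPath k ⟨s, m, p⟩ * z') = 0) hz' ?_ ?_ ?_ ?_
  · rw [mul_zero, map_zero]
  · intro z₁ z₂ h h'
    rw [mul_add, map_add, h, h', add_zero]
  · intro c z h
    rw [mul_smul'', map_smul, h, smul_zero]
  intro s' m' q hq
  by_cases h : m' = s
  · subst h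
    rw [ofPath_mul_of_eq]
    refine coeff_ofPath_of_ne k fun h => ?_
    have hlen := congrArg (fun r : AllPaths Q => r.2.2.length) h
    simp only [Quiver.Path.length_comp, Quiver.Path.length_toPath] at hlen
    omega
  · rw [ofPath_mul_of_ne k (p := ⟨s, m, p⟩) (q := ⟨s', m', q⟩) h, map_zero]

theorem arrow_mem_corner {x y : Q} (b : x ⟶ y) :
    Ideal.Quotient.mk (arrowIdeal k Q ^ 2) (arrow k b) ∈
      corner k y x (arrowIdeal k Q) (arrowIdeal k Q ^ 2) := by
  rw [mem_corner]
  refine ⟨arrow k b, ofPath_mem_arrowIdeal k _ Nat.one_pos, ?_⟩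
  rw [vertex_mul_arrow, arrow_mul_vertex]
  rfl

theorem linearIndependent_mk_arrow (x y : Q) :
    LinearIndependent k fun b : x ⟶ y =>
      (⟨_, arrow_mem_corner k b⟩ : corner k y x (arrowIdeal k Q) (arrowIdeal k Q ^ 2)) := by
  classical
  rw [linearIndependent_iff']
  intro s g hg b hb
  have h₁ : Ideal.Quotient.mk (arrowIdeal k Q ^ 2) (∑ i ∈ s, g i • arrow k i) = 0 := by
    have := congrArg Subtype.val hg
    rw [AddSubmonoidClass.coe_finsetSum] at this
    rw [map_sum]
    exact this
  have h₂ := coeff_arrow_of_mem_sq k b (Ideal.Quotient.eq_zero_iff_mem.1 h₁)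
  rw [map_sum, Finset.sum_eq_single b] at h₂
  · rw [map_smul] at h₂
    exact (mul_one (g b)).symm.trans ((congrArg (g b * ·) (coeff_ofPath_self k _).symm).trans h₂)
  · intro c _ hc
    rw [map_smul]
    refine (congrArg (g c • ·) (coeff_ofPath_of_ne k fun h => hc ?_)).trans (smul_zero _)
    simpa [Quiver.Hom.toPath] using h.symm
  · exact fun h => (h hb).elim

theorem span_mk_arrow (x y : Q) :
    ⊤ ≤ Submodule.span k (Set.range fun b : x ⟶ y =>
      (⟨_, arrow_mem_corner k b⟩ : corner k y x (arrowIdeal k Q) (arrowIdeal k Q ^ 2))) := by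
  rintro ⟨_, z, hz, rfl⟩ -
  let T : PathAlgebra k Q →ₗ[k] PathAlgebra k Q ⧸ arrowIdeal k Q ^ 2 :=
    (Submodule.mkQ (arrowIdeal k Q ^ 2)).restrictScalars k ∘ₗ
      LinearMap.mulLeftRight k (vertex k y, vertex k x)
  have hT (z) : T z = Ideal.Quotient.mk (arrowIdeal k Q ^ 2) (vertex k y * z * vertex k x) := rfl
  -- of the paths of positive length, those of length at least two lie in `J²`, and those with
  -- other endpoints are killed by `ε_y` or `ε_x`
  have key : T z ∈ Submodule.span k (Set.range fun b : x ⟶ y =>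
      Ideal.Quotient.mk (arrowIdeal k Q ^ 2) (arrow k b)) := by
    refine arrowIdeal_induction (P := fun z => T z ∈ Submodule.span k (Set.range fun b : x ⟶ y =>
      Ideal.Quotient.mk (arrowIdeal k Q ^ 2) (arrow k b))) hz ?_ (fun z z' h h' => ?_)
      (fun c z h => ?_) fun {s m} p hp => ?_
    · rw [map_zero]
      exact Submodule.zero_mem _
    · rw [map_add]
      exact Submodule.add_mem _ h h'
    · rw [map_smul]
      exact Submodule.smul_mem _ _ h
    rw [hT]
    by_cases hm : m = y
    · by_cases hs : x = s
      · subst hm hs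
        rw [vertex_mul_ofPath, ofPath_mul_vertex]
        cases p with
        | nil => exact absurd hp (lt_irrefl 0)
        | cons p b =>
          cases p with
          | nil => exact Submodule.subset_span ⟨b, rfl⟩
          | cons p c =>
            have : ofPath k ⟨x, m, (p.cons c).cons b⟩ ∈ arrowIdeal k Q ^ 2 := by
              rw [arrowIdeal_sq, ← arrow_mul_ofPath]
              exact Ideal.mul_mem_mul (ofPath_mem_arrowIdeal k _ Nat.one_pos)
                (ofPath_mem_arrowIdeal k _ (Nat.succ_pos _))
            rw [Ideal.Quotient.eq_zero_iff_mem.2 this]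
            exact Submodule.zero_mem _
      · rw [mul_assoc, ← ofPath_mul_vertex k p, mul_assoc (ofPath k _),
          vertex_mul_of_ne k (Ne.symm hs), mul_zero, mul_zero, map_zero]
        exact Submodule.zero_mem _
    · rw [← vertex_mul_ofPath k p, ← mul_assoc (vertex k y), vertex_mul_of_ne k (Ne.symm hm),
        zero_mul, zero_mul, map_zero]
      exact Submodule.zero_mem _
  have hrange : (Set.range fun b : x ⟶ y => Ideal.Quotient.mk (arrowIdeal k Q ^ 2) (arrow k b)) =
      (corner k y x (arrowIdeal k Q) (arrowIdeal k Q ^ 2)).subtype ''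
        Set.range fun b : x ⟶ y => ⟨_, arrow_mem_corner k b⟩ := by
    rw [← Set.range_comp]
    rfl
  rw [hrange, Submodule.span_image] at key
  obtain ⟨c, hc, hcz⟩ := key
  exact (Subtype.ext hcz : c = ⟨T z, z, hz, rfl⟩) ▸ hc

/-- The classes of the arrows from `x` to `y` form a basis of `ε_y (J/J²) ε_x`. -/
def arrowBasis (x y : Q) :
    Module.Basis (x ⟶ y) k (corner k y x (arrowIdeal k Q) (arrowIdeal k Q ^ 2)) :=
  Module.Basis.mk (linearIndependent_mk_arrow k x y) (span_mk_arrow k x y)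

theorem coe_arrowBasis {x y : Q} (b : x ⟶ y) :
    (arrowBasis k x y b : PathAlgebra k Q ⧸ arrowIdeal k Q ^ 2) =
      Ideal.Quotient.mk (arrowIdeal k Q ^ 2) (arrow k b) := by
  rw [arrowBasis, Module.Basis.mk_apply]

end ArrowIdeal

/-! ### The simple modules over the quotient -/

section SimpleModules

variable (k : Type u) [CommRing k] {Q : Type v} [Quiver.{w} Q] [Fintype Q]
  {I : Ideal (PathAlgebra k Q)} [I.IsTwoSided]

/-- The `kQ/I`-module structure on `(kQ/J) ε_x`, for `I ≤ J`. -/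
abbrev leftSimpleModule (hIJ : I ≤ arrowIdeal k Q) (x : Q) :
    Module (PathAlgebra k Q ⧸ I) (leftSimple k x) :=
  Module.compHom _ (Ideal.Quotient.factor hIJ)

/-- The right `kQ/I`-module structure on `ε_y (kQ/J)`, for `I ≤ J`. -/
abbrev rightSimpleModule (hIJ : I ≤ arrowIdeal k Q) (y : Q) :
    Module (PathAlgebra k Q ⧸ I)ᵐᵒᵖ (rightSimple k y) :=
  Module.compHom _ (RingHom.op (Ideal.Quotient.factor hIJ))

theorem coe_mk_smul_leftSimple (hIJ : I ≤ arrowIdeal k Q) (x : Q) (r : PathAlgebra k Q)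
    (m : leftSimple k x) :
    letI := leftSimpleModule k hIJ x
    ((Ideal.Quotient.mk I r • m : leftSimple k x) : PathAlgebra k Q ⧸ arrowIdeal k Q) =
      Ideal.Quotient.mk (arrowIdeal k Q) r * m := rfl

theorem coe_mk_smul_rightSimple (hIJ : I ≤ arrowIdeal k Q) (y : Q) (r : PathAlgebra k Q)
    (m : rightSimple k y) :
    letI := rightSimpleModule k hIJ y
    ((op (Ideal.Quotient.mk I r) • m : rightSimple k y) : PathAlgebra k Q ⧸ arrowIdeal k Q) =
      m * Ideal.Quotient.mk (arrowIdeal k Q) r := rfl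

theorem isScalarTower_rightSimple (hIJ : I ≤ arrowIdeal k Q) (y : Q) :
    letI := rightSimpleModule k hIJ y
    IsScalarTower k (PathAlgebra k Q ⧸ I)ᵐᵒᵖ (rightSimple k y) := by
  let := rightSimpleModule k hIJ y
  refine ⟨fun c s m => Subtype.ext ?_⟩
  obtain ⟨r, hr⟩ := Ideal.Quotient.mk_surjective s.unop
  obtain rfl : op (Ideal.Quotient.mk I r) = s := congrArg op hr
  exact (coe_mk_smul_rightSimple k hIJ y (c • r) m).trans
    (mul_smul_comm c (m : PathAlgebra k Q ⧸ arrowIdeal k Q) (Ideal.Quotient.mk (arrowIdeal k Q) r))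

end SimpleModules

end QuiverAlgebra

end

theorem mainTheorem6 (k : Type u) [CommRing k] (Q : Type v) [Quiver.{w} Q] [Fintype Q]
    [∀ x y : Q, Finite (x ⟶ y)]
    (I : Ideal (QuiverAlgebra.PathAlgebra k Q)) [I.IsTwoSided]
    (hI : QuiverAlgebra.IsAdmissible k I) (x y : Q) :
    let R := QuiverAlgebra.PathAlgebra k Q
    let J : Ideal R := QuiverAlgebra.arrowIdeal k Q
    (∃ (_ : Module (R ⧸ I) (QuiverAlgebra.leftSimple k x))
      (_ : Module (R ⧸ I)ᵐᵒᵖ (QuiverAlgebra.rightSimple k y))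
      (_ : IsScalarTower k (R ⧸ I)ᵐᵒᵖ (QuiverAlgebra.rightSimple k y)),
      (∀ (r : R) (m : QuiverAlgebra.leftSimple k x),
        ((Ideal.Quotient.mk I r • m : QuiverAlgebra.leftSimple k x) : R ⧸ J) =
          Ideal.Quotient.mk J r * (m : R ⧸ J)) ∧
      (∀ (r : R) (m : QuiverAlgebra.rightSimple k y),
        ((MulOpposite.op (Ideal.Quotient.mk I r) • m : QuiverAlgebra.rightSimple k y) : R ⧸ J) =
          (m : R ⧸ J) * Ideal.Quotient.mk J r) ∧
      Nonempty (QuiverAlgebra.TorModule k (R ⧸ I) (QuiverAlgebra.rightSimple k y)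
          (QuiverAlgebra.leftSimple k x) 1 ≃ₗ[k]
        QuiverAlgebra.corner k y x J (J ^ 2)) ∧
      Nonempty (QuiverAlgebra.TorModule k (R ⧸ I) (QuiverAlgebra.rightSimple k y)
          (QuiverAlgebra.leftSimple k x) 2 ≃ₗ[k]
        QuiverAlgebra.corner k y x I (I * J ⊔ J * I)) ∧
      (∀ n : ℕ, 1 ≤ n →
        Nonempty (QuiverAlgebra.TorModule k (R ⧸ I) (QuiverAlgebra.rightSimple k y)
            (QuiverAlgebra.leftSimple k x) (2 * n + 1) ≃ₗ[k]
          QuiverAlgebra.corner k y x (I ^ n * J ⊓ J * I ^ n) (I ^ (n + 1) ⊔ J * I ^ n * J))) ∧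
      (∀ n : ℕ, 2 ≤ n →
        Nonempty (QuiverAlgebra.TorModule k (R ⧸ I) (QuiverAlgebra.rightSimple k y)
            (QuiverAlgebra.leftSimple k x) (2 * n) ≃ₗ[k]
          QuiverAlgebra.corner k y x (I ^ n ⊓ J * I ^ (n - 1) * J) (I ^ n * J ⊔ J * I ^ n)))) ∧
    (∃ b : Module.Basis (x ⟶ y) k (QuiverAlgebra.corner k y x J (J ^ 2)),
      ∀ e : x ⟶ y, (b e : R ⧸ J ^ 2) = Ideal.Quotient.mk (J ^ 2) (QuiverAlgebra.PathAlgebra.arrow k e)) := by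
  intro R J
  have hsq : I ≤ J ^ 2 := hI.le_sq
  have hIJ : I ≤ J := by
    refine hsq.trans ?_
    rw [QuiverAlgebra.arrowIdeal_sq]
    exact Ideal.mul_le_left
  have : Module.Projective k (R ⧸ I) := hI.projective
  have : Module.Projective R I := QuiverAlgebra.projective_of_projective_quotient I
  have : Module.Projective R J := QuiverAlgebra.projective_of_projective_quotient J
  let := QuiverAlgebra.leftSimpleModule k hIJ x
  let := QuiverAlgebra.rightSimpleModule k hIJ y
  have hM := QuiverAlgebra.coe_mk_smul_rightSimple k hIJ y
  have hN := QuiverAlgebra.coe_mk_smul_leftSimple k hIJ x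
  have htower := QuiverAlgebra.isScalarTower_rightSimple k hIJ y
  -- `RightSpan` and `LeftSpan` unfold to `rightSimple` and `leftSimple`
  have key (n : ℕ) {C D : Ideal R}
      (hC : C = QuiverAlgebra.idealChain I J (n + 1) ⊓ J * QuiverAlgebra.idealChain I J n)
      (hD : D = QuiverAlgebra.idealChain I J (n + 2) ⊔ J * QuiverAlgebra.idealChain I J (n + 1)) :
      Nonempty (QuiverAlgebra.TorModule k (R ⧸ I) (QuiverAlgebra.rightSimple k y)
        (QuiverAlgebra.leftSimple k x) (n + 1) ≃ₗ[k] QuiverAlgebra.corner k y x C D) :=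
    let : Module (R ⧸ I)ᵐᵒᵖ (QuiverAlgebra.RightSpan J (QuiverAlgebra.PathAlgebra.vertex k y)) :=
      QuiverAlgebra.rightSimpleModule k hIJ y
    let : Module (R ⧸ I) (QuiverAlgebra.LeftSpan J (QuiverAlgebra.PathAlgebra.vertex k x)) :=
      QuiverAlgebra.leftSimpleModule k hIJ x
    have : IsScalarTower k (R ⧸ I)ᵐᵒᵖ
      (QuiverAlgebra.RightSpan J (QuiverAlgebra.PathAlgebra.vertex k y)) := htower
    QuiverAlgebra.nonempty_torModule_linearEquiv_idempotentCorner hM hN hIJ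
      (QuiverAlgebra.vertex_mul_self k y) (QuiverAlgebra.vertex_mul_self k x) n hC hD
  have heven (n : ℕ) : QuiverAlgebra.idealChain I J (2 * n) = I ^ n :=
    QuiverAlgebra.idealChain_even I J n
  have hodd (n : ℕ) : QuiverAlgebra.idealChain I J (2 * n + 1) = I ^ n * J :=
    QuiverAlgebra.idealChain_odd I J n
  refine ⟨⟨inferInstance, inferInstance, htower, hN, hM, ?_, ?_, ?_, ?_⟩,
    QuiverAlgebra.arrowBasis k x y, QuiverAlgebra.coe_arrowBasis k⟩
  · refine key 0 ?_ ?_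
    · change J = J ⊓ J * ⊤
      rw [Ideal.mul_top, inf_idem]
    · change J ^ 2 = I * ⊤ ⊔ J * J
      rw [Ideal.mul_top, ← QuiverAlgebra.arrowIdeal_sq, sup_eq_right.2 hsq]
  · refine key 1 ?_ ?_
    · change I = I * ⊤ ⊓ J * J
      rw [Ideal.mul_top, ← QuiverAlgebra.arrowIdeal_sq, inf_eq_left.2 hsq]
    · change I * J ⊔ J * I = I * J ⊔ J * (I * ⊤)
      rw [Ideal.mul_top]
  · intro n _
    refine key (2 * n) ?_ ?_
    · rw [heven, hodd]
    · rw [hodd, show 2 * n + 2 = 2 * (n + 1) from rfl, heven, mul_assoc]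
  · intro n hn
    obtain ⟨n, rfl⟩ : ∃ m, n = m + 1 := ⟨n - 1, by omega⟩
    refine key (2 * n + 1) ?_ ?_
    · rw [hodd, show 2 * n + 1 + 1 = 2 * (n + 1) from rfl, heven, mul_assoc, Nat.add_sub_cancel]
    · rw [show 2 * n + 1 + 1 = 2 * (n + 1) from rfl, heven,
        show 2 * n + 1 + 2 = 2 * (n + 1) + 1 from rfl, hodd]
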